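/- Let $G=(V,E)$ be a finite connected graph without loops, $n=|V|$, with edge weights $w_{ij}=w_{ji}>0$ for $\{i,j\}\in E$, a vertex measure $\mu_i>0$ and a potential $\kappa_i\in\mathbb R$ for $i\in V$. Let $\Gamma=(G,\sigma)$ be the signed graph with the all-negative signature $\sigma\equiv-1$. For $p>1$ put $\Psi_p(t)=|t|^{p-2}t$ for $t\neq0$ and $\Psi_p(0)=0$. The signed $p$-Laplacian is $$\Delta_p^\sigma f(i)=\sum_{j\sim i}w_{ij}\Psi_p\bigl(f(i)-\sigma_{ij}f(j)\bigr)+\kappa_i\Psi_p(f(i)),\qquad f:V\to\mathbb R,\ i\in V,$$ and $f\neq0$ is an eigenfunction corresponding to $\lambda\in\mathbb R$ if $\Delta_p^\sigma f(i)=\lambda\mu_i\Psi_p(f(i))$ for all $i\in V$. Let $\mathcal S_p=\{f:V\to\mathbb R:\ \sum_{i}\mu_i|f(i)|^p=1\}$ and $$\mathcal R_p^\sigma(f)=\frac{\sum_{\{i,j\}\in E}w_{ij}|f(i)-\sigma_{ij}f(j)|^p+\sum_i\kappa_i|f(i)|^p}{\sum_i\mu_i|f(i)|^p}.$$ For a nonempty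 closed symmetric set $B$ let the index $\gamma(B)$ be the least integer $k\ge1$ such that there is an odd continuous map $B\to\mathbb R^k\setminus\{0\}$ ($\gamma(B)=\infty$ if there is none). The variational eigenvalues are $$\lambda_k^{(p)}=\min_{B}\max_{f\in B}\mathcal R_p^\sigma(f),\qquad 1\le k\le n,$$ where $B$ runs over the nonempty closed symmetric subsets of $\mathcal S_p$ with $\gamma(B)\ge k$. Let $A_{-\Gamma}$ be the matrix with $(i,j)$ entry $-\sigma_{ij}w_{ij}=w_{ij}$ if $i\sim j$ and $0$ otherwise, let $D=\operatorname{diag}(\mu_i)$, and let $A^\mu_{-\Gamma}=D^{-1}A_{-\Gamma}$. For every real $p>1$ let $f^{(p)}\in\mathcal S_p$ be an eigenfunction of $\Delta_p^\sigma$ corresponding to $\lambda_n^{(p)}$. Then for every $i\in V$ the limit $f(i):=\lim_{p\to\infty}|f^{(p)}(i)|^{p/2}$ exists, and the function $f$ is an eigenvector of $A^\mu_{-\Gamma}$ (in particular $f\neq0$) corresponding to its largest eigenvalue. -/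

import Mathlib

open Filter Topology

noncomputable section

/-- A finite signed graph on the vertex set `V`: a simple graph together with a signature, a
positive edge weight, a positive vertex measure and an arbitrary real potential. The signature and
the weight are only ever evaluated at edges; their values at other unordered pairs are
irrelevant. -/
structure SignedGraph (V : Type*) where
  graph : SimpleGraph V
  sign : Sym2 V → ℤˣ
  weight : Sym2 V → ℝ
  weight_pos : ∀ e ∈ graph.edgeSet, 0 < weight e
  measure : V → ℝ
  measure_pos : ∀ i, 0 < measure i
  potential : V → ℝ

/-- `Ψ_p(t) = |t|^(p-2) t` for `t ≠ 0`, and `Ψ_p(0) = 0`. -/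
def psi (p t : ℝ) : ℝ := if t = 0 then 0 else |t| ^ (p - 2) * t

/-- The index (Krasnoselskii genus) of a set `B`: the least positive integer `k` for which there is
an odd continuous map from `B` to `ℝ^k ∖ {0}`, and `⊤` if there is none. It is used for nonempty
closed symmetric sets only. -/
def krasnoselskiiGenus {E : Type*} [TopologicalSpace E] [Neg E] (B : Set E) : ℕ∞ :=
  sInf {N : ℕ∞ | ∃ k : ℕ, N = (k : ℕ∞) ∧ 1 ≤ k ∧ ∃ h : E → (Fin k → ℝ),
    ContinuousOn h B ∧ (∀ x ∈ B, h (-x) = -h x) ∧ ∀ x ∈ B, h x ≠ 0}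

namespace SignedGraph

variable {V : Type*}

/-- The negation `-Γ`: all signs are reversed, everything else is kept. -/
def negation (Γ : SignedGraph V) : SignedGraph V := { Γ with sign := fun e => -Γ.sign e }

/-- The sign `σ_{ij}` as a real number. -/
def sgn (Γ : SignedGraph V) (i j : V) : ℝ := ((Γ.sign s(i, j) : ℤ) : ℝ)

open Classical in
/-- The adjacency matrix `A_Γ`, with entries `σ_{ij} w_{ij}` at edges and `0` elsewhere. -/
def adjacency (Γ : SignedGraph V) : Matrix V V ℝ :=
  Matrix.of fun i j => if Γ.graph.Adj i j then Γ.sgn i j * Γ.weight s(i, j) else 0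

variable [Fintype V]

/-- The normalized adjacency matrix `D⁻¹ A_Γ`, where `D` is the diagonal matrix of the vertex
measure. -/
def normalizedAdjacency [DecidableEq V] (Γ : SignedGraph V) : Matrix V V ℝ :=
  (Matrix.diagonal Γ.measure)⁻¹ * Γ.adjacency

open Classical in
/-- The signed `p`-Laplacian. -/
def pLaplacian (Γ : SignedGraph V) (p : ℝ) (f : V → ℝ) (i : V) : ℝ :=
  (∑ j, if Γ.graph.Adj i j then Γ.weight s(i, j) * psi p (f i - Γ.sgn i j * f j) else 0)
    + Γ.potential i * psi p (f i)

/-- `(lam, f)` is an eigenpair of the signed `p`-Laplacian. -/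
def IsEigenpair (Γ : SignedGraph V) (p lam : ℝ) (f : V → ℝ) : Prop :=
  f ≠ 0 ∧ ∀ i, Γ.pLaplacian p f i = lam * Γ.measure i * psi p (f i)

/-- The unit sphere `S_p` of the `ℓ^p(μ)` norm. -/
def unitSphere (Γ : SignedGraph V) (p : ℝ) : Set (V → ℝ) :=
  {f | ∑ i, Γ.measure i * |f i| ^ p = 1}

open Classical in
/-- The sum over all edges `{i, j}` of `w_{ij} |f i - σ_{ij} f j|^p`. The summand is symmetric in
`i` and `j`, and the double sum counts every edge twice. -/
def edgeEnergy (Γ : SignedGraph V) (p : ℝ) (f : V → ℝ) : ℝ :=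
  (∑ i, ∑ j,
    if Γ.graph.Adj i j then Γ.weight s(i, j) * |f i - Γ.sgn i j * f j| ^ p else 0) / 2

/-- The Rayleigh quotient of the signed `p`-Laplacian. -/
def rayleigh (Γ : SignedGraph V) (p : ℝ) (f : V → ℝ) : ℝ :=
  (Γ.edgeEnergy p f + ∑ i, Γ.potential i * |f i| ^ p) / ∑ i, Γ.measure i * |f i| ^ p

/-- The family `F_k(S_p)` of nonempty closed symmetric subsets of `S_p` of index at least `k`. -/
def genusFamily (Γ : SignedGraph V) (p : ℝ) (k : ℕ) : Set (Set (V → ℝ)) :=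
  {B | B ⊆ Γ.unitSphere p ∧ B.Nonempty ∧ IsClosed B ∧ (∀ x ∈ B, -x ∈ B) ∧ (k : ℕ∞) ≤ krasnoselskiiGenus B}

/-- The `k`-th variational eigenvalue `min_{B ∈ F_k(S_p)} max_{f ∈ B} R_p(f)`, `1 ≤ k ≤ n`. -/
def variationalEigenvalue (Γ : SignedGraph V) (p : ℝ) (k : ℕ) : ℝ :=
  sInf ((fun B => sSup (Γ.rayleigh p '' B)) '' Γ.genusFamily p k)

end SignedGraph

end

/-! Put `u p = |f p| ^ (p / 2)`. The constraint `f p ∈ Γ.unitSphere p` then says that `u p` is a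
nonnegative unit vector of weighted `ℓ²`, so the `u p` live in one compact set.

For `k = |V|` the min-max collapses. By `borsuk_ulam` the whole sphere has index at least `|V|`,
while a closed symmetric proper subset misses some pair `±x` and projects along `x` without zeros
into dimension `|V| - 1`. Hence the sphere is the only competitor, the top eigenvalue is the maximum
of the Rayleigh quotient, and `f p` attains it.

Since all signs are `-1`, an edge contributes `|f i + f j| ^ p`, at most `2 ^ p` times `powerMeanSq
p (u i) (u j)`, with equality when `f ≥ 0`. After division by `2 ^ p` the potential is negligible,
and `powerMeanSq p a b` decreases to `a * b` as `p → ∞`. So every cluster point of `u p` maximizes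
`∑ w_ij u_i u_j` over nonnegative unit vectors. By Perron–Frobenius
(`exists_unique_nonneg_maximizer`) there is one such maximizer, an eigenvector for the largest
eigenvalue; compactness gives convergence.

Borsuk–Ulam is proved algebraically. After Stone–Weierstrass approximation, the odd part of a
polynomial map on the sphere becomes a system of `m` equations of odd degree `d` in `m` unknowns. A
generic small perturbation makes its coordinate ring an algebra of odd dimension `d ^ m`, and such
an algebra has a real point. -/

noncomputable section

/-! ### Real points of odd-dimensional algebras -/

theorem Polynomial.exists_isRoot_of_monic_of_odd {P : Polynomial ℝ} (hP : P.Monic)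
    (hodd : Odd P.natDegree) : ∃ t, P.IsRoot t := by
  have hdeg : 0 < P.degree := Polynomial.natDegree_pos_iff_degree_pos.1 hodd.pos
  have h1 := P.tendsto_atTop_of_leadingCoeff_nonneg hdeg (by rw [hP.leadingCoeff]; norm_num)
  have hnd : (P.comp (-Polynomial.X)).natDegree = P.natDegree := by
    rw [Polynomial.natDegree_comp]; simp
  have h2 := (P.comp (-Polynomial.X)).tendsto_atBot_of_leadingCoeff_nonpos
    (Polynomial.natDegree_pos_iff_degree_pos.1 (hnd ▸ hodd.pos)) (by
      rw [Polynomial.leadingCoeff_comp (by simp), hP.leadingCoeff]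
      simp [hodd.neg_one_pow])
  obtain ⟨a, ha⟩ := (h1.eventually (eventually_ge_atTop 0)).exists
  obtain ⟨b, hb⟩ := (h2.eventually (eventually_le_atBot 0)).exists
  have hb' : P.eval (-b) ≤ 0 := by simpa [Polynomial.eval_comp] using hb
  obtain ⟨t, ht⟩ := mem_range_of_exists_le_of_exists_ge (c := (0 : ℝ)) P.continuous
    ⟨-b, hb'⟩ ⟨a, ha⟩
  exact ⟨t, ht⟩

theorem Module.End.exists_hasEigenvalue_of_odd_finrank {W : Type*} [AddCommGroup W] [Module ℝ W]
    (hodd : Odd (Module.finrank ℝ W)) (φ : Module.End ℝ W) : ∃ t, φ.HasEigenvalue t := by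
  have : Module.Finite ℝ W := Module.finite_of_finrank_pos hodd.pos
  obtain ⟨t, ht⟩ := Polynomial.exists_isRoot_of_monic_of_odd (LinearMap.charpoly_monic φ)
    (by rwa [LinearMap.charpoly_natDegree])
  exact ⟨t, (Module.End.hasEigenvalue_iff_isRoot_charpoly φ t).2 ht⟩

/-- A commutative real algebra of odd dimension has a real point. -/
theorem exists_algHom_real_of_odd_finrank (n : ℕ) : ∀ (C : Type*) [CommRing C] [Algebra ℝ C],
    Module.finrank ℝ C = n → Odd n → Nonempty (C →ₐ[ℝ] ℝ) := by
  induction n using Nat.strong_induction_on with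
  | _ n ih =>
  intro C _ _ hn hodd
  have : Module.Finite ℝ C := Module.finite_of_finrank_pos (hn ▸ hodd.pos)
  have hnt : Nontrivial C := Module.nontrivial_of_finrank_pos (R := ℝ) (hn ▸ hodd.pos)
  by_cases hsurj : Function.Surjective (algebraMap ℝ C)
  · exact ⟨(AlgEquiv.ofBijective (Algebra.ofId ℝ C)
      ⟨(algebraMap ℝ C).injective, hsurj⟩).symm.toAlgHom⟩
  · simp only [Function.Surjective, not_forall, not_exists] at hsurj
    obtain ⟨x, hx⟩ := hsurj
    obtain ⟨t, ht⟩ := Module.End.exists_hasEigenvalue_of_odd_finrank (hn ▸ hodd)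
      (LinearMap.mulLeft ℝ x)
    obtain ⟨v, hv⟩ := ht.exists_hasEigenvector
    -- `z` is a nonzero zero divisor. The quotients by `z C` and by its annihilator have dimensions
    -- adding up to the odd number `n`, both less than `n`, so one of them is odd and the induction
    -- applies to it.
    set z : C := x - algebraMap ℝ C t with hz
    have hz0 : z ≠ 0 := fun h => hx t (sub_eq_zero.1 h).symm
    have hzv : z * v = 0 := by
      have := hv.apply_eq_smul
      rw [LinearMap.mulLeft_apply, Algebra.smul_def] at this
      rw [hz, sub_mul, this, sub_self]
    set μ := LinearMap.mulLeft ℝ z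
    have hrk := μ.finrank_range_add_finrank_ker
    set J : Ideal C := Ideal.span {z}
    set A : Ideal C := LinearMap.ker (LinearMap.mulLeft C z)
    have hJ : (J.restrictScalars ℝ) = LinearMap.range μ := by
      ext y
      simp [J, μ, Ideal.mem_span_singleton', mul_comm]
    have hA : (A.restrictScalars ℝ) = LinearMap.ker μ := by
      ext y
      simp [A, μ]
    have qJ : Module.finrank ℝ (C ⧸ J) + Module.finrank ℝ (LinearMap.range μ) = n := by
      rw [← hn, ← hJ]
      exact Submodule.finrank_quotient_add_finrank (J.restrictScalars ℝ)
    have qA : Module.finrank ℝ (C ⧸ A) + Module.finrank ℝ (LinearMap.ker μ) = n := by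
      rw [← hn, ← hA]
      exact Submodule.finrank_quotient_add_finrank (A.restrictScalars ℝ)
    have pR : 0 < Module.finrank ℝ (LinearMap.range μ) := by
      rw [Module.finrank_pos_iff_exists_ne_zero]
      exact ⟨⟨z, 1, by simp [μ]⟩, fun h => hz0 (congrArg Subtype.val h)⟩
    have pK : 0 < Module.finrank ℝ (LinearMap.ker μ) := by
      rw [Module.finrank_pos_iff_exists_ne_zero]
      exact ⟨⟨v, by simp [μ, hzv]⟩, fun h => hv.2 (congrArg Subtype.val h)⟩
    rw [hn] at hrk
    rcases Nat.even_or_odd (Module.finrank ℝ (C ⧸ J)) with hJe | hJo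
    · have hAo : Odd (Module.finrank ℝ (C ⧸ A)) := by
        have : Module.finrank ℝ (C ⧸ A) = Module.finrank ℝ (LinearMap.range μ) := by omega
        rw [this]
        rw [Nat.odd_iff] at hodd ⊢
        rw [Nat.even_iff] at hJe
        omega
      obtain ⟨φ⟩ := ih _ (by omega) (C ⧸ A) rfl hAo
      exact ⟨φ.comp (Ideal.Quotient.mkₐ ℝ A)⟩
    · obtain ⟨φ⟩ := ih _ (by omega) (C ⧸ J) rfl hJo
      exact ⟨φ.comp (Ideal.Quotient.mkₐ ℝ J)⟩

/-! ### Zeros of perturbed polynomial systems of odd degree -/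

namespace MvPolynomial

variable {σ : Type*} [Fintype σ]

/-- The polynomial `X^(c mod d) * G^(c div d)`, a deformation of the monomial `X^c`. -/
def deformedMonomial {R : Type*} [CommSemiring R] (G : σ → MvPolynomial σ R) (d : ℕ)
    (c : σ →₀ ℕ) : MvPolynomial σ R :=
  ∏ i, (X i ^ (c i % d) * G i ^ (c i / d))

theorem deformedMonomial_X_pow {R : Type*} [CommSemiring R] (d : ℕ) (c : σ →₀ ℕ) :
    deformedMonomial (fun i => (X i : MvPolynomial σ R) ^ d) d c = monomial c 1 := by
  rw [monomial_eq, Finsupp.prod_fintype _ _ (by simp)]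
  simp only [deformedMonomial, C_1, one_mul]
  refine Finset.prod_congr rfl fun i _ => ?_
  rw [← pow_mul, ← pow_add, Nat.mod_add_div]

theorem map_deformedMonomial {R S : Type*} [CommSemiring R] [CommSemiring S] (φ : R →+* S)
    (G : σ → MvPolynomial σ R) (d : ℕ) (c : σ →₀ ℕ) :
    map φ (deformedMonomial G d c) = deformedMonomial (fun i => map φ (G i)) d c := by
  simp [deformedMonomial, map_prod]

theorem totalDegree_deformedMonomial_le {R : Type*} [CommSemiring R] {G : σ → MvPolynomial σ R}
    {d : ℕ} (hG : ∀ i, (G i).totalDegree ≤ d) (c : σ →₀ ℕ) :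
    (deformedMonomial G d c).totalDegree ≤ c.degree := by
  rw [Finsupp.degree_eq_sum]
  refine (totalDegree_finsetProd _ _).trans (Finset.sum_le_sum fun i _ => ?_)
  refine (totalDegree_mul _ _).trans ?_
  have h1 : (X i ^ (c i % d) : MvPolynomial σ R).totalDegree ≤ c i % d := by
    rcases subsingleton_or_nontrivial R with _ | _
    · simp [Subsingleton.elim (X i ^ (c i % d) : MvPolynomial σ R) 0]
    · simp
  have h2 : (G i ^ (c i / d)).totalDegree ≤ c i / d * d :=
    (totalDegree_pow _ _).trans (Nat.mul_le_mul_left _ (hG i))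
  have := Nat.mod_add_div' (c i) d
  omega

theorem dvd_deformedMonomial {R : Type*} [CommSemiring R] (G : σ → MvPolynomial σ R)
    {d : ℕ} (hd : 0 < d) {c : σ →₀ ℕ} {i : σ} (hi : d ≤ c i) : G i ∣ deformedMonomial G d c :=
  ((dvd_pow_self _ (Nat.div_pos hi hd).ne').mul_left _).trans
    (Finset.dvd_prod_of_mem (fun i => X i ^ (c i % d) * G i ^ (c i / d)) (Finset.mem_univ i))

theorem deformedMonomial_add_single [DecidableEq σ] {R : Type*} [CommSemiring R]
    (G : σ → MvPolynomial σ R) {d : ℕ} (hd : 0 < d) (c : σ →₀ ℕ) (i : σ) :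
    deformedMonomial G d (c + Finsupp.single i d) = G i * deformedMonomial G d c := by
  have h : ∀ j, (X j ^ ((c + Finsupp.single i d) j % d) *
      G j ^ ((c + Finsupp.single i d) j / d) : MvPolynomial σ R) =
      (if j = i then G i else 1) * (X j ^ (c j % d) * G j ^ (c j / d)) := by
    intro j
    by_cases hj : j = i
    · subst hj
      simp [Nat.add_div_right _ hd, pow_succ]
      ring
    · simp [hj]
  simp only [deformedMonomial, h, Finset.prod_mul_distrib]
  simp

/-- The linear map that sends each monomial to its deformation. -/
def deformation {R : Type*} [CommSemiring R] (G : σ → MvPolynomial σ R) (d : ℕ) :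
    MvPolynomial σ R →ₗ[R] MvPolynomial σ R :=
  (basisMonomials σ R).constr R (deformedMonomial G d)

theorem deformation_monomial {R : Type*} [CommSemiring R] (G : σ → MvPolynomial σ R) (d : ℕ)
    (c : σ →₀ ℕ) (r : R) : deformation G d (monomial c r) = r • deformedMonomial G d c := by
  have h : monomial c r = r • basisMonomials σ R c := by simp [smul_monomial]
  rw [h, map_smul, deformation, Module.Basis.constr_basis]

theorem deformation_apply {R : Type*} [CommSemiring R] (G : σ → MvPolynomial σ R) (d : ℕ)
    (p : MvPolynomial σ R) :
    deformation G d p = ∑ c ∈ p.support, p.coeff c • deformedMonomial G d c := by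
  conv_lhs => rw [p.as_sum, map_sum]
  simp only [deformation_monomial]

/-- The deformation intertwines multiplication by `X i ^ d` with multiplication by `G i`. When
bijective, it therefore carries the ideal `(X_i ^ d)` onto `(G_i)`. -/
theorem mul_deformation [DecidableEq σ] {R : Type*} [CommSemiring R] (G : σ → MvPolynomial σ R)
    {d : ℕ} (hd : 0 < d) (i : σ) (p : MvPolynomial σ R) :
    G i * deformation G d p = deformation G d (p * X i ^ d) := by
  induction p using MvPolynomial.induction_on' with
  | monomial c r =>
    have : (monomial c r * X i ^ d : MvPolynomial σ R) = monomial (c + Finsupp.single i d) r := by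
      rw [X_pow_eq_monomial, monomial_mul, mul_one]
    rw [this, deformation_monomial, deformation_monomial, deformedMonomial_add_single G hd,
      mul_smul_comm]
  | add p q hp hq => rw [map_add, mul_add, hp, hq, add_mul, map_add]

/-- If the deformation is bijective then `(G_i)` cuts out a scheme of degree `d ^ |σ|`. -/
theorem finrank_quotient_of_bijective_deformation {K : Type*} [Field K]
    (G : σ → MvPolynomial σ K) {d : ℕ} (hd : 0 < d)
    (hbij : Function.Bijective (deformation G d)) :
    Module.finrank K (MvPolynomial σ K ⧸ Ideal.span (Set.range G)) = d ^ Fintype.card σ := by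
  classical
  let Φ := LinearEquiv.ofBijective (deformation G d) hbij
  let ι : (σ → Fin d) → (σ →₀ ℕ) := fun a => Finsupp.equivFunOnFinite.symm fun i => (a i : ℕ)
  have hι : Function.Injective ι := fun a b h => by
    funext i
    exact Fin.ext (DFunLike.congr_fun h i)
  -- `π` reads off the coefficients of monomials with all exponents below `d`, so its kernel is
  -- `(X_i ^ d)`; transported by `Φ`, the kernel becomes `(G_i)`.
  let π : MvPolynomial σ K →ₗ[K] ((σ → Fin d) → K) := LinearMap.pi fun a => lcoeff K (ι a)
  have hπ : ∀ q a, π q a = q.coeff (ι a) := fun q a => rfl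
  have hπsurj : Function.Surjective π := fun v => by
    refine ⟨∑ a, monomial (ι a) (v a), ?_⟩
    funext b
    rw [hπ, coeff_sum]
    simp [coeff_monomial, hι.eq_iff]
  let T : MvPolynomial σ K →ₗ[K] ((σ → Fin d) → K) := π ∘ₗ Φ.symm.toLinearMap
  have hT : Function.Surjective T := hπsurj.comp Φ.symm.surjective
  have hker : LinearMap.ker T = (Ideal.span (Set.range G)).restrictScalars K := by
    ext p
    obtain ⟨q, rfl⟩ := Φ.surjective p
    rw [Submodule.restrictScalars_mem, LinearMap.mem_ker]
    have hTq : T (Φ q) = π q := by simp [T]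
    rw [hTq]
    have hΦ : ∀ q, Φ q = deformation G d q := fun q => rfl
    constructor
    · intro h
      rw [hΦ, deformation_apply]
      refine Submodule.sum_mem _ fun c hc => Submodule.smul_of_tower_mem _ _ ?_
      by_cases hbig : ∃ i, d ≤ c i
      · obtain ⟨i, hi⟩ := hbig
        exact Ideal.mem_of_dvd _ (dvd_deformedMonomial G hd hi) (Ideal.subset_span ⟨i, rfl⟩)
      · push Not at hbig
        have := congrFun h fun i => ⟨c i, hbig i⟩
        rw [hπ] at this
        have hc' : ι (fun i => ⟨c i, hbig i⟩) = c := by ext; simp [ι]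
        rw [hc'] at this
        exact absurd this (mem_support_iff.1 hc)
    · intro h
      obtain ⟨a, ha⟩ := (Submodule.mem_span_range_iff_exists_fun _).1 h
      have hq : q = ∑ i, Φ.symm (a i) * X i ^ d := by
        apply Φ.injective
        rw [← ha, map_sum]
        refine Finset.sum_congr rfl fun i _ => ?_
        rw [hΦ, ← mul_deformation G hd, ← hΦ, Φ.apply_symm_apply, smul_eq_mul, mul_comm]
      funext b
      rw [hπ, hq, coeff_sum]
      refine Finset.sum_eq_zero fun i _ => ?_
      rw [X_pow_eq_monomial, coeff_mul_monomial', if_neg]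
      rw [Finsupp.single_le_iff]
      simp [ι]
  have e := LinearMap.quotKerEquivOfSurjective T hT
  rw [hker] at e
  have := LinearEquiv.finrank_eq e
  rw [Module.finrank_pi, Fintype.card_fun, Fintype.card_fin] at this
  exact this

/-- The polynomials of bounded total degree form finite-dimensional invariant subspaces, on each of
which injectivity forces surjectivity. -/
theorem bijective_of_injective_of_totalDegree_le {K : Type*} [Field K]
    (Φ : MvPolynomial σ K →ₗ[K] MvPolynomial σ K) (hinj : Function.Injective Φ)
    (hdeg : ∀ p, (Φ p).totalDegree ≤ p.totalDegree) : Function.Bijective Φ := by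
  refine ⟨hinj, fun p => ?_⟩
  have hmaps : ∀ q ∈ restrictTotalDegree σ K p.totalDegree,
      Φ q ∈ restrictTotalDegree σ K p.totalDegree := fun q hq => by
    rw [mem_restrictTotalDegree] at hq ⊢
    exact (hdeg q).trans hq
  have hinj' : Function.Injective (Φ.restrict hmaps) := fun a b h =>
    Subtype.ext (hinj (congrArg Subtype.val h))
  obtain ⟨q, hq⟩ := LinearMap.injective_iff_surjective.1 hinj'
    ⟨p, (mem_restrictTotalDegree _ _ _).2 le_rfl⟩
  exact ⟨q, congrArg Subtype.val hq⟩

theorem totalDegree_deformation_le {R : Type*} [CommSemiring R] {G : σ → MvPolynomial σ R}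
    {d : ℕ} (hG : ∀ i, (G i).totalDegree ≤ d) (p : MvPolynomial σ R) :
    (deformation G d p).totalDegree ≤ p.totalDegree := by
  rw [deformation_apply]
  refine totalDegree_finsetSum_le fun c hc => (totalDegree_smul_le _ _).trans ?_
  refine (totalDegree_deformedMonomial_le hG c).trans ?_
  exact le_totalDegree hc

/-- The segment from `g` (at `s = 0`) to the pure powers `X_i ^ d` (at `s = 1`). -/
def segmentToPowers (g : σ → MvPolynomial σ ℝ) (d : ℕ) (s : ℝ) (i : σ) : MvPolynomial σ ℝ :=
  C (1 - s) * g i + C s * X i ^ d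

theorem totalDegree_segmentToPowers_le {τ : Type*} {g : τ → MvPolynomial τ ℝ} {d : ℕ}
    (hg : ∀ i, (g i).totalDegree ≤ d) (s : ℝ) (i : τ) :
    (segmentToPowers g d s i).totalDegree ≤ d := by
  refine (totalDegree_add _ _).trans (max_le ?_ ?_)
  · exact (totalDegree_mul _ _).trans (by
      rw [totalDegree_C, zero_add]; exact hg i)
  · exact (totalDegree_mul _ _).trans (by simp)

/-- On degree at most `k` the deformation has a matrix whose determinant is a polynomial in `s`,
equal to `1` at `s = 1` where the deformation is the identity. Each `k` thus excludes finitely many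
`s`. -/
theorem countable_not_bijective_deformation {g : σ → MvPolynomial σ ℝ} {d : ℕ}
    (hg : ∀ i, (g i).totalDegree ≤ d) :
    {s : ℝ | ¬ Function.Bijective (deformation (segmentToPowers g d s) d)}.Countable := by
  classical
  let I : ℕ → Type _ := fun k => {c : σ →₀ ℕ // c.degree ≤ k}
  have hfin : ∀ k, Finite (I k) := fun k => (Finsupp.finite_of_degree_le k).to_subtype
  have : ∀ k, Fintype (I k) := fun k => Fintype.ofFinite _
  let G : σ → MvPolynomial σ (Polynomial ℝ) := fun i =>
    C (1 - Polynomial.X) * map Polynomial.C (g i) + C Polynomial.X * X i ^ d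
  have hG : ∀ s i, map (Polynomial.evalRingHom s) (G i) = segmentToPowers g d s i := by
    intro s i
    have : (Polynomial.evalRingHom s).comp Polynomial.C = RingHom.id ℝ := by ext; simp
    simp [G, segmentToPowers, map_map, this, map_id]
  let M : ∀ k, Matrix (I k) (I k) (Polynomial ℝ) := fun k =>
    Matrix.of fun c e => coeff e.1 (deformedMonomial G d c.1)
  have hM : ∀ k s c e, (M k c e).eval s =
      coeff e.1 (deformedMonomial (segmentToPowers g d s) d c.1) := by
    intro k s c e
    have h := map_deformedMonomial (Polynomial.evalRingHom s) G d c.1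
    simp only [hG] at h
    rw [← h, coeff_map]
    rfl
  have hdet : ∀ k s, (M k).det.eval s = ((M k).map (Polynomial.eval s)).det := by
    intro k s
    exact RingHom.map_det (Polynomial.evalRingHom s) (M k)
  have hone : ∀ k, (M k).det ≠ 0 := by
    intro k h0
    have h1 := hdet k 1
    have : (M k).map (Polynomial.eval 1) = 1 := by
      ext c e
      rw [Matrix.map_apply, hM]
      have hX : segmentToPowers g d 1 = fun i => X i ^ d := by
        funext i
        simp [segmentToPowers]
      rw [hX, deformedMonomial_X_pow, coeff_monomial, Matrix.one_apply]
      by_cases h : c = e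
      · rw [if_pos (congrArg Subtype.val h), if_pos h]
      · rw [if_neg fun h' => h (Subtype.ext h'), if_neg h]
    rw [this, h0] at h1
    simp at h1
  refine (Set.countable_iUnion fun k => ((M k).det.roots.toFinset : Set ℝ).toFinite.countable).mono
    fun s hs => ?_
  by_contra hcon
  refine hs (bijective_of_injective_of_totalDegree_le _ ?_
    (totalDegree_deformation_le (totalDegree_segmentToPowers_le hg s)))
  rw [injective_iff_map_eq_zero]
  intro p hp
  set k := p.totalDegree
  have hk : (M k).det.eval s ≠ 0 := fun h => hcon (Set.mem_iUnion.2 ⟨k, by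
    simpa [hone k] using h⟩)
  rw [hdet] at hk
  have hsub : ∀ c ∈ p.support, c.degree ≤ k := fun c hc => le_totalDegree hc
  have hv : Matrix.vecMul (fun c : I k => coeff c.1 p) ((M k).map (Polynomial.eval s)) = 0 := by
    funext e
    have h0 : coeff e.1 (deformation (segmentToPowers g d s) d p) = 0 := by rw [hp]; simp
    rw [deformation_apply, coeff_sum] at h0
    simp only [coeff_smul, smul_eq_mul] at h0
    rw [Pi.zero_apply, ← h0]
    simp only [Matrix.vecMul, dotProduct, Matrix.map_apply, hM]
    rw [← Finset.sum_subtype_of_mem (p := fun c : σ →₀ ℕ => c.degree ≤ k)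
      (fun c => coeff c p * coeff e.1 (deformedMonomial (segmentToPowers g d s) d c)) hsub]
    symm
    refine Finset.sum_subset (Finset.subset_univ _) fun c _ hc => ?_
    have : coeff c.1 p = 0 := by
      by_contra hne
      exact hc (Finset.mem_subtype.2 (mem_support_iff.2 hne))
    rw [this, zero_mul]
  have hz := Matrix.eq_zero_of_vecMul_eq_zero hk hv
  ext c
  rw [coeff_zero]
  by_contra hne
  exact hne (congrFun hz ⟨c, hsub c (mem_support_iff.2 hne)⟩)

/-- A system of `|σ|` real polynomials of degree at most an odd `d` acquires a real zero after an
arbitrarily small perturbation of the coefficients of the `X_i ^ d`. -/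
theorem exists_zero_segmentToPowers {g : σ → MvPolynomial σ ℝ} {d : ℕ}
    (hg : ∀ i, (g i).totalDegree ≤ d) (hd : Odd d) {ε : ℝ} (hε : 0 < ε) :
    ∃ s ∈ Set.Ioo 0 ε, ∃ y : σ → ℝ, ∀ i, (1 - s) * eval y (g i) + s * y i ^ d = 0 := by
  obtain ⟨s, hs, hmem⟩ := (countable_not_bijective_deformation hg).dense_compl ℝ
    |>.exists_mem_open isOpen_Ioo (Set.nonempty_Ioo.2 hε)
  refine ⟨s, hmem, ?_⟩
  have hbij : Function.Bijective (deformation (segmentToPowers g d s) d) := not_not.1 hs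
  -- The coordinate ring has dimension `d ^ |σ|`, which is odd; the images of the variables under a
  -- real point form the zero.
  have hrank := finrank_quotient_of_bijective_deformation _ hd.pos hbij
  obtain ⟨φ⟩ := exists_algHom_real_of_odd_finrank _ _ hrank hd.pow
  let ψ : MvPolynomial σ ℝ →ₐ[ℝ] ℝ := φ.comp (Ideal.Quotient.mkₐ ℝ _)
  refine ⟨fun i => ψ (X i), fun i => ?_⟩
  have hψ : ∀ p, ψ p = eval (fun i => ψ (X i)) p := fun p => by
    conv_lhs => rw [aeval_unique ψ]
    rfl
  have h0 : ψ (segmentToPowers g d s i) = 0 := by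
    have : Ideal.Quotient.mk (Ideal.span (Set.range (segmentToPowers g d s)))
        (segmentToPowers g d s i) = 0 :=
      Ideal.Quotient.eq_zero_iff_mem.2 (Ideal.subset_span ⟨i, rfl⟩)
    simp [ψ, this]
  rw [hψ] at h0
  simpa [segmentToPowers] using h0

end MvPolynomial

/-! ### Polynomial approximation and the Borsuk–Ulam theorem -/

open MvPolynomial in
theorem MvPolynomial.exists_near_of_isCompact {τ : Type*} {K : Set (τ → ℝ)} (hK : IsCompact K)
    {F : (τ → ℝ) → ℝ} (hF : ContinuousOn F K) {δ : ℝ} (hδ : 0 < δ) :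
    ∃ P : MvPolynomial τ ℝ, ∀ x ∈ K, |eval x P - F x| < δ := by
  have : CompactSpace K := isCompact_iff_compactSpace.1 hK
  let X' : τ → C(K, ℝ) := fun i =>
    ⟨fun x => x.1 i, (continuous_apply i).comp continuous_subtype_val⟩
  let A : Subalgebra ℝ C(K, ℝ) := (MvPolynomial.aeval X').range
  have hA : A.SeparatesPoints := by
    intro x y hxy
    obtain ⟨i, hi⟩ := Function.ne_iff.1 (fun h => hxy (Subtype.ext h) : x.1 ≠ y.1)
    exact ⟨X' i, ⟨X' i, ⟨MvPolynomial.X i, by simp⟩, rfl⟩, hi⟩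
  obtain ⟨⟨_, P, rfl⟩, hP⟩ :=
    ContinuousMap.exists_mem_subalgebra_near_continuous_of_separatesPoints A hA
      (fun x : K => F x.1) hF.domRestrict δ hδ
  refine ⟨P, fun x hx => ?_⟩
  have h := hP ⟨x, hx⟩
  have he : (aeval X' P : C(K, ℝ)) ⟨x, hx⟩ = eval x P := by
    clear h hP
    induction P using MvPolynomial.induction_on with
    | C a => simp
    | add p q hp hq => simp only [map_add, ContinuousMap.add_apply, hp, hq]
    | mul_X p i hp => simp only [map_mul, ContinuousMap.mul_apply, hp, aeval_X, eval_X]; rfl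
  rw [Real.norm_eq_abs] at h
  rw [← he]
  exact h

namespace MvPolynomial

variable {σ : Type*} [Fintype σ]

/-- The odd part of `P`, made homogeneous of degree `d` by powers of the squared norm, and
restricted to the affine hyperplane where the coordinate `none` is `1`. -/
def oddDehomogenization (P : MvPolynomial (Option σ) ℝ) (d : ℕ) : MvPolynomial σ ℝ :=
  ∑ c ∈ P.support with Odd c.degree,
    C (P.coeff c) * ((∏ i, X i ^ c (some i)) * (1 + ∑ i, X i ^ 2) ^ ((d - c.degree) / 2))

theorem totalDegree_oddDehomogenization_le {P : MvPolynomial (Option σ) ℝ} {d : ℕ}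
    (hP : P.totalDegree ≤ d) : (oddDehomogenization P d).totalDegree ≤ d := by
  refine totalDegree_finsetSum_le fun c hc => ?_
  have hcd : c.degree ≤ d := (le_totalDegree (Finset.mem_filter.1 hc).1).trans hP
  refine (totalDegree_mul _ _).trans ?_
  rw [totalDegree_C, zero_add]
  refine (totalDegree_mul _ _).trans ?_
  have h1 : (∏ i, X i ^ c (some i) : MvPolynomial σ ℝ).totalDegree ≤ ∑ i, c (some i) :=
    (totalDegree_finsetProd _ _).trans (Finset.sum_le_sum fun i _ => by simp)
  have h2 : (1 + ∑ i, X i ^ 2 : MvPolynomial σ ℝ).totalDegree ≤ 2 := by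
    refine (totalDegree_add _ _).trans (max_le (by simp) ?_)
    exact totalDegree_finsetSum_le fun i _ => by simp
  have h3 : ((1 + ∑ i, X i ^ 2 : MvPolynomial σ ℝ) ^ ((d - c.degree) / 2)).totalDegree
      ≤ (d - c.degree) / 2 * 2 := (totalDegree_pow _ _).trans (Nat.mul_le_mul_left _ h2)
  have h4 : c.degree = c none + ∑ i, c (some i) := by
    rw [Finsupp.degree_eq_sum, Fintype.sum_option]
  omega

/-- The point of the unit sphere in the direction of `(y, 1)`. -/
def projectToSphere (y : σ → ℝ) : Option σ → ℝ :=
  fun o => o.elim 1 y / √(1 + ∑ i, y i ^ 2)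

theorem one_add_sum_sq_pos (y : σ → ℝ) : 0 < 1 + ∑ i, y i ^ 2 := by positivity

theorem sum_sq_projectToSphere (y : σ → ℝ) : ∑ o, projectToSphere y o ^ 2 = 1 := by
  have h := one_add_sum_sq_pos y
  simp only [projectToSphere, div_pow, Real.sq_sqrt h.le, ← Finset.sum_div]
  rw [Fintype.sum_option]
  simp [h.ne']

/-- This translates affine zeros into zeros on the sphere: up to a positive factor the value is the
odd part of `P` at the projected point. -/
theorem eval_oddDehomogenization {P : MvPolynomial (Option σ) ℝ} {d : ℕ}
    (hP : P.totalDegree ≤ d) (hd : Odd d) (y : σ → ℝ) :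
    eval y (oddDehomogenization P d) = √(1 + ∑ i, y i ^ 2) ^ d *
      ((eval (projectToSphere y) P - eval (-projectToSphere y) P) / 2) := by
  set r := √(1 + ∑ i, y i ^ 2) with hr
  have hr0 : 0 < r := Real.sqrt_pos.2 (one_add_sum_sq_pos y)
  have hr2 : 1 + ∑ i, y i ^ 2 = r ^ 2 := (Real.sq_sqrt (one_add_sum_sq_pos y).le).symm
  have hneg : ∀ c : Option σ →₀ ℕ, ∏ o, (-projectToSphere y) o ^ c o =
      (-1) ^ c.degree * ∏ o, projectToSphere y o ^ c o := by
    intro c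
    rw [Finsupp.degree_eq_sum, ← Finset.prod_pow_eq_pow_sum, ← Finset.prod_mul_distrib]
    exact Finset.prod_congr rfl fun o _ => by rw [Pi.neg_apply, neg_pow]
  have hpos : ∀ c : Option σ →₀ ℕ,
      r ^ c.degree * ∏ o, projectToSphere y o ^ c o = ∏ i, y i ^ c (some i) := by
    intro c
    rw [Finsupp.degree_eq_sum, ← Finset.prod_pow_eq_pow_sum, ← Finset.prod_mul_distrib]
    rw [Fintype.prod_option]
    simp only [projectToSphere, ← hr, ← mul_pow, mul_div_cancel₀ _ hr0.ne', Option.elim]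
    simp
  rw [eval_eq' (projectToSphere y), eval_eq' (-projectToSphere y), ← Finset.sum_sub_distrib,
    Finset.sum_div, Finset.mul_sum,
    oddDehomogenization, map_sum, Finset.sum_filter]
  refine Finset.sum_congr rfl fun c hc => ?_
  have hcd : c.degree ≤ d := (le_totalDegree hc).trans hP
  rw [hneg]
  split_ifs with hodd
  -- Both `d` and `c.degree` are odd, so the halving loses nothing.
  · have he : 2 * ((d - c.degree) / 2) = d - c.degree :=
      Nat.two_mul_div_two_of_even (Nat.Odd.sub_odd hd hodd)
    simp only [map_mul, eval_C, map_prod, map_pow, eval_X, map_add, map_one, map_sum]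
    rw [hr2, ← pow_mul, he, ← hpos, hodd.neg_one_pow]
    have : r ^ d = r ^ c.degree * r ^ (d - c.degree) := by
      rw [← pow_add, Nat.add_sub_cancel' hcd]
    rw [this]
    ring
  · rw [(Nat.not_odd_iff_even.1 hodd).neg_one_pow]
    ring

end MvPolynomial

open MvPolynomial in
/-- **Borsuk–Ulam theorem**: an odd continuous map from the unit sphere of dimension `m` to `ℝ^m`
has a zero. -/
theorem borsuk_ulam {σ : Type*} [Fintype σ] {h : (Option σ → ℝ) → σ → ℝ}
    (hcont : ContinuousOn h {x | ∑ o, x o ^ 2 = 1})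
    (hodd : ∀ x, ∑ o, x o ^ 2 = 1 → h (-x) = -h x) : ∃ x, ∑ o, x o ^ 2 = 1 ∧ h x = 0 := by
  set S : Set (Option σ → ℝ) := {x | ∑ o, x o ^ 2 = 1} with hS
  have hbound : ∀ x ∈ S, ∀ o, |x o| ≤ 1 := fun x hx o => by
    rw [← sq_le_one_iff_abs_le_one, ← (hx : ∑ o, x o ^ 2 = 1)]
    exact Finset.single_le_sum (f := fun o => x o ^ 2) (fun o _ => sq_nonneg _) (Finset.mem_univ o)
  have hK : IsCompact S := by
    refine Metric.isCompact_of_isClosed_isBounded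
      (isClosed_eq (by fun_prop) continuous_const) ?_
    refine (Metric.isBounded_closedBall (x := 0) (r := 1)).subset fun x hx => ?_
    rw [mem_closedBall_zero_iff]
    exact (pi_norm_le_iff_of_nonneg zero_le_one).2 fun o => hbound x hx o
  by_contra! hne
  have hSne : S.Nonempty := ⟨projectToSphere 0, sum_sq_projectToSphere 0⟩
  obtain ⟨x₀, hx₀, hmin⟩ := hK.exists_isMinOn hSne hcont.norm
  set δ := ‖h x₀‖ with hδ
  have hδ0 : 0 < δ := norm_pos_iff.2 (hne x₀ hx₀)
  have happ : ∀ i, ∃ P : MvPolynomial (Option σ) ℝ, ∀ x ∈ S, |eval x P - h x i| < δ / 2 :=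
    fun i => exists_near_of_isCompact hK ((continuous_apply i).comp_continuousOn hcont)
      (half_pos hδ0)
  choose P hP using happ
  set d := 2 * (∑ i, (P i).totalDegree) + 1
  have hdeg : ∀ i, (P i).totalDegree ≤ d := fun i => by
    have := Finset.single_le_sum (f := fun i => (P i).totalDegree) (fun _ _ => Nat.zero_le _)
      (Finset.mem_univ i)
    grind
  have hd : Odd d := ⟨_, rfl⟩
  -- At the zero, the odd part `q` of `P i` satisfies `(1 - s) q = -s x_i ^ d`. With `s < 1/2` this
  -- gives `|q| ≤ 2 s`, and `s < δ/4` makes it less than `δ/2`. As `h` is odd, `q` is within `δ/2`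
  -- of `h x i`, so `‖h x‖ < δ`, against minimality.
  obtain ⟨s, ⟨hs0, hs1⟩, y, hy⟩ := exists_zero_segmentToPowers
    (fun i => totalDegree_oddDehomogenization_le (hdeg i)) hd
    (lt_min (by norm_num : (0 : ℝ) < 1 / 2) (by positivity : 0 < δ / 4))
  obtain ⟨hs2, hs3⟩ := lt_min_iff.1 hs1
  set x := projectToSphere y
  have hx : x ∈ S := sum_sq_projectToSphere y
  have hnx : -x ∈ S := by simpa [hS] using hx
  refine absurd (isMinOn_iff.1 hmin x hx) (not_le.2 ?_)
  refine (pi_norm_lt_iff hδ0).2 fun i => ?_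
  rw [Real.norm_eq_abs]
  set r := √(1 + ∑ i, y i ^ 2) with hr
  have hr0 : 0 < r := Real.sqrt_pos.2 (one_add_sum_sq_pos y)
  have hyx : y i = r * x (some i) := by
    simp only [x, projectToSphere, Option.elim, ← hr]
    field_simp
  have hQ : (1 - s) * ((eval x (P i) - eval (-x) (P i)) / 2) + s * x (some i) ^ d = 0 := by
    have h1 := hy i
    rw [eval_oddDehomogenization (hdeg i) hd, ← hr, hyx, mul_pow] at h1
    have : r ^ d * ((1 - s) * ((eval x (P i) - eval (-x) (P i)) / 2) + s * x (some i) ^ d) = 0 := by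
      linear_combination h1
    exact (mul_eq_zero.1 this).resolve_left (pow_pos hr0 d).ne'
  have h1 := abs_lt.1 (hP i x hx)
  have h2 := abs_lt.1 (hP i (-x) hnx)
  rw [hodd x hx, Pi.neg_apply] at h2
  have hp : |x (some i) ^ d| ≤ 1 := by
    rw [abs_pow]
    exact pow_le_one₀ (abs_nonneg _) (hbound x hx _)
  have h3 := abs_le.1 hp
  set q := (eval x (P i) - eval (-x) (P i)) / 2 with hq
  have hqb : |q| ≤ 2 * s := by
    rw [abs_le]
    constructor <;> nlinarith
  have h4 := abs_le.1 hqb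
  rw [abs_lt]
  constructor <;> linarith

/-! ### The index of the sphere and the top variational eigenvalue -/

theorem psi_mul_self {p : ℝ} (hp : 1 < p) (t : ℝ) : psi p t * t = |t| ^ p := by
  unfold psi
  split_ifs with h
  · rw [h, abs_zero, Real.zero_rpow (by linarith), mul_zero]
  · have hpos : 0 < |t| := abs_pos.2 h
    have : |t| ^ p = |t| ^ (p - 2) * |t| ^ (2 : ℕ) := by
      rw [← Real.rpow_natCast, ← Real.rpow_add hpos]
      norm_num
    rw [this, sq_abs]
    ring

theorem psi_neg (p t : ℝ) : psi p (-t) = -psi p t := by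
  unfold psi
  split_ifs with h h' h' <;> simp_all

namespace SignedGraph

variable {V : Type*}

theorem sgn_comm (Γ : SignedGraph V) (i j : V) : Γ.sgn i j = Γ.sgn j i := by
  rw [sgn, sgn, Sym2.eq_swap]

theorem sgn_eq_one_or (Γ : SignedGraph V) (i j : V) : Γ.sgn i j = 1 ∨ Γ.sgn i j = -1 := by
  rcases Int.units_eq_one_or (Γ.sign s(i, j)) with h | h <;> simp [sgn, h]

variable [Fintype V]

theorem continuous_sum_abs_rpow (c : V → ℝ) {p : ℝ} (hp : 0 < p) :
    Continuous fun f : V → ℝ => ∑ i, c i * |f i| ^ p :=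
  continuous_finsetSum _ fun i _ => continuous_const.mul
    ((continuous_apply i).abs.rpow_const fun _ => Or.inr hp.le)

theorem sum_measure_abs_rpow_smul (Γ : SignedGraph V) (p c : ℝ) (f : V → ℝ) :
    ∑ i, Γ.measure i * |(c • f) i| ^ p = |c| ^ p * ∑ i, Γ.measure i * |f i| ^ p := by
  rw [Finset.mul_sum]
  refine Finset.sum_congr rfl fun i _ => ?_
  rw [Pi.smul_apply, smul_eq_mul, abs_mul, Real.mul_rpow (abs_nonneg _) (abs_nonneg _)]
  ring

theorem sum_measure_abs_rpow_pos (Γ : SignedGraph V) (p : ℝ) {f : V → ℝ} (hf : f ≠ 0) :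
    0 < ∑ i, Γ.measure i * |f i| ^ p := by
  obtain ⟨i, hi⟩ := Function.ne_iff.1 hf
  refine Finset.sum_pos' (fun j _ => mul_nonneg (Γ.measure_pos j).le (by positivity))
    ⟨i, Finset.mem_univ i, mul_pos (Γ.measure_pos i) ?_⟩
  exact Real.rpow_pos_of_pos (abs_pos.2 hi) p

theorem ne_zero_of_mem_unitSphere {Γ : SignedGraph V} {p : ℝ} (hp : 0 < p) {f : V → ℝ}
    (hf : f ∈ Γ.unitSphere p) : f ≠ 0 := by
  rintro rfl
  simp [unitSphere, Real.zero_rpow hp.ne'] at hf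

theorem isClosed_unitSphere (Γ : SignedGraph V) {p : ℝ} (hp : 0 < p) :
    IsClosed (Γ.unitSphere p) :=
  isClosed_eq (continuous_sum_abs_rpow _ hp) continuous_const

theorem isCompact_unitSphere (Γ : SignedGraph V) {p : ℝ} (hp : 0 < p) :
    IsCompact (Γ.unitSphere p) := by
  refine Metric.isCompact_of_isClosed_isBounded (Γ.isClosed_unitSphere hp) ?_
  refine (Metric.isBounded_Icc (α := V → ℝ) (fun i => -((Γ.measure i)⁻¹ ^ p⁻¹))
    (fun i => (Γ.measure i)⁻¹ ^ p⁻¹)).subset fun f hf => ?_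
  have h : ∀ i, |f i| ≤ (Γ.measure i)⁻¹ ^ p⁻¹ := fun i => by
    have hi := Γ.measure_pos i
    rw [Real.le_rpow_inv_iff_of_pos (abs_nonneg _) (by positivity) hp,
      ← one_div, le_div_iff₀' hi, ← (hf : ∑ i, Γ.measure i * |f i| ^ p = 1)]
    exact Finset.single_le_sum (f := fun i => Γ.measure i * |f i| ^ p)
      (fun j _ => mul_nonneg (Γ.measure_pos j).le (by positivity)) (Finset.mem_univ i)
  exact ⟨fun i => (abs_le.1 (h i)).1, fun i => (abs_le.1 (h i)).2⟩

theorem neg_mem_unitSphere {Γ : SignedGraph V} {p : ℝ} {f : V → ℝ} (hf : f ∈ Γ.unitSphere p) :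
    -f ∈ Γ.unitSphere p := by
  simpa [unitSphere] using hf

theorem smul_mem_unitSphere {Γ : SignedGraph V} {p : ℝ} (hp : 0 < p) {f : V → ℝ} (hf : f ≠ 0) :
    (∑ i, Γ.measure i * |f i| ^ p) ^ (-p⁻¹) • f ∈ Γ.unitSphere p := by
  have h := Γ.sum_measure_abs_rpow_pos p hf
  rw [unitSphere, Set.mem_ofPred_eq, sum_measure_abs_rpow_smul,
    abs_of_pos (Real.rpow_pos_of_pos h _), ← Real.rpow_mul h.le, neg_mul, inv_mul_cancel₀ hp.ne',
    Real.rpow_neg_one, inv_mul_cancel₀ h.ne']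

/-- Radial projection from the Euclidean sphere is odd and continuous, so an odd zero-free map into
a smaller dimension would contradict Borsuk–Ulam. -/
theorem card_le_krasnoselskiiGenus_unitSphere [Nonempty V] (Γ : SignedGraph V) {p : ℝ}
    (hp : 0 < p) : (Fintype.card V : ℕ∞) ≤ krasnoselskiiGenus (Γ.unitSphere p) := by
  refine le_sInf ?_
  rintro _ ⟨k, rfl, hk, h, hcont, hodd, hne⟩
  rw [Nat.cast_le]
  by_contra! hlt
  obtain ⟨m, hm⟩ : ∃ m, Fintype.card V = m + 1 := ⟨Fintype.card V - 1, by omega⟩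
  have e : V ≃ Option (Fin m) := Fintype.equivOfCardEq (by simp [hm])
  let pull : (Option (Fin m) → ℝ) → V → ℝ := fun x i => x (e i)
  have hpull : ∀ x : Option (Fin m) → ℝ, ∑ o, x o ^ 2 = 1 → pull x ≠ 0 := by
    intro x hx h0
    have : x = 0 := funext fun o => by simpa [pull] using congrFun h0 (e.symm o)
    simp [this] at hx
  let φ : (Option (Fin m) → ℝ) → V → ℝ := fun x =>
    (∑ i, Γ.measure i * |pull x i| ^ p) ^ (-p⁻¹) • pull x
  have hφ : ∀ x, ∑ o, x o ^ 2 = 1 → φ x ∈ Γ.unitSphere p := fun x hx =>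
    smul_mem_unitSphere hp (hpull x hx)
  have hφneg : ∀ x, φ (-x) = -φ x := fun x => by
    have : pull (-x) = -pull x := rfl
    simp [φ, this]
  have hφcont : ContinuousOn φ {x | ∑ o, x o ^ 2 = 1} := by
    have hpc : Continuous pull := by fun_prop
    refine ContinuousOn.smul (f := fun x => (∑ i, Γ.measure i * |pull x i| ^ p) ^ (-p⁻¹)) ?_
      hpc.continuousOn
    refine ContinuousOn.rpow_const ((continuous_sum_abs_rpow _ hp).comp hpc).continuousOn ?_
    exact fun x hx => Or.inl (Γ.sum_measure_abs_rpow_pos p (hpull x hx)).ne'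
  let pad : (Fin k → ℝ) → Fin m → ℝ := fun y i => if hi : (i : ℕ) < k then y ⟨i, hi⟩ else 0
  have hpad : Continuous pad := by
    refine continuous_pi fun i => ?_
    by_cases hi : (i : ℕ) < k
    · simpa [pad, hi] using continuous_apply _
    · simpa [pad, hi] using continuous_const
  obtain ⟨x, hx, hx0⟩ := borsuk_ulam (h := fun x => pad (h (φ x)))
    (hpad.comp_continuousOn (hcont.comp hφcont hφ)) (fun x hx => by
      funext i
      by_cases hi : (i : ℕ) < k <;> simp [pad, hi, hφneg, hodd _ (hφ x hx)])
  refine hne _ (hφ x hx) (funext fun j => ?_)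
  have hj : (j : ℕ) < m := by omega
  simpa [pad] using congrFun hx0 ⟨j, hj⟩

/-- A closed symmetric subset of the sphere that omits a point has index less than `|V|`. -/
theorem eq_unitSphere_of_mem_genusFamily [Nonempty V] {Γ : SignedGraph V} {p : ℝ} (hp : 0 < p)
    {B : Set (V → ℝ)} (hB : B ∈ Γ.genusFamily p (Fintype.card V)) : B = Γ.unitSphere p := by
  obtain ⟨hsub, ⟨y₀, hy₀⟩, -, hsymm, hgenus⟩ := hB
  refine hsub.antisymm fun x hx => ?_
  by_contra hxB
  have hx0 := ne_zero_of_mem_unitSphere hp hx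
  let W := Submodule.span ℝ {x}
  have hdim : Module.finrank ℝ ((V → ℝ) ⧸ W) + 1 = Fintype.card V := by
    rw [← finrank_span_singleton (K := ℝ) hx0, Submodule.finrank_quotient_add_finrank,
      Module.finrank_fintype_fun_eq_card]
  let e : ((V → ℝ) ⧸ W) ≃ₗ[ℝ] (Fin (Module.finrank ℝ ((V → ℝ) ⧸ W)) → ℝ) :=
    LinearEquiv.ofFinrankEq _ _ (by simp)
  let L : (V → ℝ) →ₗ[ℝ] (Fin (Module.finrank ℝ ((V → ℝ) ⧸ W)) → ℝ) := e.toLinearMap ∘ₗ W.mkQ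
  -- The line through `x` meets the sphere only in `±x`, and by symmetry `B` contains neither.
  have hL : ∀ y ∈ B, L y ≠ 0 := by
    intro y hy h0
    have hyW : y ∈ W := by
      have : W.mkQ y = 0 := e.injective (by simpa [L] using h0)
      simpa using this
    obtain ⟨c, rfl⟩ := Submodule.mem_span_singleton.1 hyW
    have h1 : ∑ i, Γ.measure i * |(c • x) i| ^ p = 1 := hsub hy
    rw [sum_measure_abs_rpow_smul, (hx : ∑ i, Γ.measure i * |x i| ^ p = 1), mul_one,
      ← Real.one_rpow p, Real.rpow_left_inj (abs_nonneg c) zero_le_one hp.ne'] at h1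
    rcases abs_eq zero_le_one |>.1 h1 with rfl | rfl
    · exact hxB (by simpa using hy)
    · exact hxB (by simpa using hsymm _ hy)
  -- The index only admits `k ≥ 1`. In a zero-dimensional quotient `L` would vanish at `y₀`.
  have hpos : 1 ≤ Module.finrank ℝ ((V → ℝ) ⧸ W) := by
    by_contra! h
    refine hL y₀ hy₀ (funext fun j => absurd j.2 (by omega))
  have hle : krasnoselskiiGenus B ≤ (Module.finrank ℝ ((V → ℝ) ⧸ W) : ℕ∞) :=
    sInf_le ⟨_, rfl, hpos, L, (LinearMap.continuous_of_finiteDimensional L).continuousOn,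
      fun y _ => map_neg L y, hL⟩
  have := Nat.cast_le.1 (hgenus.trans hle)
  omega

theorem genusFamily_card [Nonempty V] (Γ : SignedGraph V) {p : ℝ} (hp : 0 < p) :
    Γ.genusFamily p (Fintype.card V) = {Γ.unitSphere p} := by
  refine Set.eq_singleton_iff_unique_mem.2 ⟨⟨subset_rfl, ?_, Γ.isClosed_unitSphere hp,
    fun _ => neg_mem_unitSphere, Γ.card_le_krasnoselskiiGenus_unitSphere hp⟩,
    fun B => eq_unitSphere_of_mem_genusFamily hp⟩
  exact ⟨_, smul_mem_unitSphere hp (one_ne_zero : (1 : V → ℝ) ≠ 0)⟩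

/-- The top variational eigenvalue is the maximum of the Rayleigh quotient. -/
theorem variationalEigenvalue_card [Nonempty V] (Γ : SignedGraph V) {p : ℝ} (hp : 0 < p) :
    Γ.variationalEigenvalue p (Fintype.card V) = sSup (Γ.rayleigh p '' Γ.unitSphere p) := by
  rw [variationalEigenvalue, Γ.genusFamily_card hp, Set.image_singleton, csInf_singleton]

theorem rayleigh_of_mem_unitSphere {Γ : SignedGraph V} {p : ℝ} {f : V → ℝ}
    (hf : f ∈ Γ.unitSphere p) :
    Γ.rayleigh p f = Γ.edgeEnergy p f + ∑ i, Γ.potential i * |f i| ^ p := by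
  rw [rayleigh, (hf : ∑ i, Γ.measure i * |f i| ^ p = 1), div_one]

theorem continuous_edgeEnergy (Γ : SignedGraph V) {p : ℝ} (hp : 0 < p) :
    Continuous (Γ.edgeEnergy p) := by
  classical
  unfold edgeEnergy
  refine Continuous.div_const (continuous_finsetSum _ fun i _ => continuous_finsetSum _
    fun j _ => ?_) _
  split_ifs
  · refine continuous_const.mul (Continuous.rpow_const (by fun_prop) fun _ => Or.inr hp.le)
  · exact continuous_const

theorem le_variationalEigenvalue_card [Nonempty V] {Γ : SignedGraph V} {p : ℝ} (hp : 0 < p)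
    {f : V → ℝ} (hf : f ∈ Γ.unitSphere p) :
    Γ.edgeEnergy p f + ∑ i, Γ.potential i * |f i| ^ p ≤
      Γ.variationalEigenvalue p (Fintype.card V) := by
  rw [Γ.variationalEigenvalue_card hp, ← rayleigh_of_mem_unitSphere hf]
  -- Compactness of the sphere supplies the bound without which `sSup` would be a default value.
  refine le_csSup ?_ ⟨f, hf, rfl⟩
  refine (Γ.isCompact_unitSphere hp).bddAbove_image ?_
  refine ContinuousOn.congr ?_ fun g hg => rayleigh_of_mem_unitSphere hg
  exact ((Γ.continuous_edgeEnergy hp).add (continuous_sum_abs_rpow _ hp)).continuousOn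

/-- Summation by parts: the two orientations of an edge combine into `psi p t * t`, because `psi` is
odd and the sign is `±1`. -/
theorem sum_mul_pLaplacian (Γ : SignedGraph V) {p : ℝ} (hp : 1 < p) (f : V → ℝ) :
    ∑ i, f i * Γ.pLaplacian p f i =
      Γ.edgeEnergy p f + ∑ i, Γ.potential i * |f i| ^ p := by
  classical
  let T : V → V → ℝ := fun i j =>
    if Γ.graph.Adj i j then Γ.weight s(i, j) * psi p (f i - Γ.sgn i j * f j) * f i else 0
  have hT : ∀ i j, T i j + T j i =
      if Γ.graph.Adj i j then Γ.weight s(i, j) * |f i - Γ.sgn i j * f j| ^ p else 0 := by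
    intro i j
    by_cases h : Γ.graph.Adj i j
    · simp only [T, h, h.symm, if_true, Γ.sgn_comm j i, Sym2.eq_swap (a := j) (b := i),
        ← psi_mul_self hp]
      rcases Γ.sgn_eq_one_or i j with hs | hs
      · have : f j - 1 * f i = -(f i - 1 * f j) := by ring
        rw [hs, this, psi_neg]
        ring
      · have : f j - -1 * f i = f i - -1 * f j := by ring
        rw [hs, this]
        ring
    · have h' : ¬ Γ.graph.Adj j i := fun h' => h h'.symm
      simp only [T, h, h', if_false, add_zero]
  have hL : ∀ i, f i * Γ.pLaplacian p f i = ∑ j, T i j + Γ.potential i * |f i| ^ p := by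
    intro i
    rw [pLaplacian, mul_add, Finset.mul_sum, ← psi_mul_self hp]
    congr 1
    · refine Finset.sum_congr rfl fun j _ => ?_
      simp only [T]
      split_ifs <;> ring
    · ring
  simp only [hL, Finset.sum_add_distrib]
  congr 1
  have h2 : Γ.edgeEnergy p f = (∑ i, ∑ j, (T i j + T j i)) / 2 := by
    simp only [hT, edgeEnergy]
  rw [h2]
  simp only [Finset.sum_add_distrib]
  rw [Finset.sum_comm (f := fun i j => T j i)]
  ring

theorem IsEigenpair.eq_of_mem_unitSphere {Γ : SignedGraph V} {p lam : ℝ} (hp : 1 < p) {f : V → ℝ}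
    (h : Γ.IsEigenpair p lam f) (hf : f ∈ Γ.unitSphere p) :
    lam = Γ.edgeEnergy p f + ∑ i, Γ.potential i * |f i| ^ p := by
  rw [← Γ.sum_mul_pLaplacian hp]
  have : ∀ i, f i * Γ.pLaplacian p f i = lam * (Γ.measure i * |f i| ^ p) := fun i => by
    rw [h.2 i, ← psi_mul_self hp]
    ring
  simp only [this, ← Finset.mul_sum]
  rw [(hf : ∑ i, Γ.measure i * |f i| ^ p = 1), mul_one]

end SignedGraph

/-! ### Power means and their limit -/

/-- The `p`-th power of the arithmetic mean of `a^(2/p)` and `b^(2/p)`, that is, the square of the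
power mean of `a` and `b` with exponent `2/p`. -/
def powerMeanSq (p a b : ℝ) : ℝ := ((a ^ (2 / p) + b ^ (2 / p)) / 2) ^ p

theorem mul_le_powerMeanSq {p a b : ℝ} (hp : 0 < p) (ha : 0 ≤ a) (hb : 0 ≤ b) :
    a * b ≤ powerMeanSq p a b := by
  have h : ∀ x : ℝ, 0 ≤ x → x ^ (2 / p) = (x ^ p⁻¹) ^ 2 := fun x hx => by
    rw [← Real.rpow_natCast, ← Real.rpow_mul hx]
    congr 1
    push_cast
    field_simp
  have h1 : a ^ p⁻¹ * b ^ p⁻¹ ≤ (a ^ (2 / p) + b ^ (2 / p)) / 2 := by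
    rw [h a ha, h b hb]
    linarith [two_mul_le_add_sq (a ^ p⁻¹) (b ^ p⁻¹)]
  calc a * b = (a ^ p⁻¹ * b ^ p⁻¹) ^ p := by
        rw [← Real.mul_rpow ha hb, ← Real.rpow_mul (mul_nonneg ha hb), inv_mul_cancel₀ hp.ne',
          Real.rpow_one]
    _ ≤ _ := Real.rpow_le_rpow (by positivity) h1 hp.le

/-- Convexity of `x ↦ x ^ (q / p)`. Monotonicity allows the moving exponent to be replaced by a
fixed one before passing to a cluster point. -/
theorem powerMeanSq_anti {p q a b : ℝ} (hp : 0 < p) (hpq : p ≤ q) (ha : 0 ≤ a) (hb : 0 ≤ b) :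
    powerMeanSq q a b ≤ powerMeanSq p a b := by
  have hq := hp.trans_le hpq
  have ht : 1 ≤ q / p := (one_le_div hp).2 hpq
  have h : ∀ x : ℝ, 0 ≤ x → (x ^ (2 / q)) ^ (q / p) = x ^ (2 / p) := fun x hx => by
    rw [← Real.rpow_mul hx]
    congr 1
    field_simp
  have h1 := (convexOn_rpow ht).2 (Real.rpow_nonneg ha (2 / q)) (Real.rpow_nonneg hb (2 / q))
    (by norm_num : (0 : ℝ) ≤ 1 / 2) (by norm_num : (0 : ℝ) ≤ 1 / 2) (by norm_num)
  simp only [smul_eq_mul] at h1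
  rw [h a ha, h b hb] at h1
  have h2 := Real.rpow_le_rpow (by positivity) h1 hp.le
  rw [← Real.rpow_mul (by positivity), div_mul_cancel₀ q hp.ne'] at h2
  unfold powerMeanSq
  convert h2 using 2 <;> ring

theorem tendsto_powerMeanSq_zero_left {b : ℝ} (hb : 0 ≤ b) :
    Tendsto (fun p => powerMeanSq p 0 b) atTop (𝓝 0) := by
  have h : Tendsto (fun p : ℝ => b ^ (2 : ℝ) * (1 / 2 : ℝ) ^ p) atTop (𝓝 (b ^ (2 : ℝ) * 0)) :=
    (tendsto_rpow_atTop_of_base_lt_one _ (by norm_num) (by norm_num)).const_mul _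
  rw [mul_zero] at h
  refine h.congr' ?_
  filter_upwards [eventually_gt_atTop 0] with p hp
  rw [powerMeanSq, Real.zero_rpow (by positivity), zero_add, div_eq_mul_one_div (b ^ (2 / p)),
    Real.mul_rpow (by positivity) (by norm_num), ← Real.rpow_mul hb, div_mul_cancel₀ _ hp.ne']

theorem powerMeanSq_comm (p a b : ℝ) : powerMeanSq p a b = powerMeanSq p b a := by
  rw [powerMeanSq, powerMeanSq, add_comm]

/-- Power means tend to the geometric mean as the exponent tends to zero. -/
theorem tendsto_powerMeanSq {a b : ℝ} (ha : 0 ≤ a) (hb : 0 ≤ b) :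
    Tendsto (fun p => powerMeanSq p a b) atTop (𝓝 (a * b)) := by
  rcases ha.eq_or_lt with rfl | ha
  · simpa using tendsto_powerMeanSq_zero_left hb
  rcases hb.eq_or_lt with rfl | hb
  · simpa [powerMeanSq_comm _ a 0] using tendsto_powerMeanSq_zero_left ha.le
  -- This function vanishes at `0`, and its difference quotient at `x = 1 / p` is the logarithm of
  -- `powerMeanSq p a b`.
  have hd : HasDerivAt (fun x : ℝ => Real.log ((a ^ (2 * x) + b ^ (2 * x)) / 2))
      (Real.log a + Real.log b) 0 := by
    have h2 : HasDerivAt (fun x : ℝ => 2 * x) 2 0 := by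
      simpa using (hasDerivAt_id (0 : ℝ)).const_mul 2
    have hadd : HasDerivAt (fun x : ℝ => a ^ (2 * x) + b ^ (2 * x))
        (Real.log a * 2 * a ^ ((2 : ℝ) * 0) + Real.log b * 2 * b ^ ((2 : ℝ) * 0)) 0 :=
      (h2.const_rpow ha).add (h2.const_rpow hb)
    have h := (hadd.div_const 2).log (by simp)
    convert h using 1
    simp only [mul_zero, Real.rpow_zero]
    ring
  have hs := hd.tendsto_slope_zero_right.comp tendsto_inv_atTop_nhdsGT_zero
  have he := (Real.continuous_exp.tendsto _).comp hs
  rw [Real.exp_add, Real.exp_log ha, Real.exp_log hb] at he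
  refine he.congr' ?_
  filter_upwards [eventually_gt_atTop 0] with p hp
  have hpos : 0 < (a ^ (2 / p) + b ^ (2 / p)) / 2 := by positivity
  rw [powerMeanSq, Real.rpow_def_of_pos hpos]
  simp [← div_eq_mul_inv, mul_comm (Real.log _)]

theorem continuous_powerMeanSq {p : ℝ} (hp : 0 < p) :
    Continuous fun x : ℝ × ℝ => powerMeanSq p x.1 x.2 := by
  have h : 0 ≤ 2 / p := by positivity
  refine Continuous.rpow_const ?_ fun _ => Or.inr hp.le
  exact ((continuous_fst.rpow_const fun _ => Or.inr h).add
    (continuous_snd.rpow_const fun _ => Or.inr h)).div_const 2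

/-! ### Perron–Frobenius for connected weighted graphs -/

theorem eq_zero_of_forall_two_mul_mul_add_nonpos {b c : ℝ}
    (h : ∀ t : ℝ, 2 * t * b + t ^ 2 * c ≤ 0) : b = 0 := by
  have hs : 0 < |c| + 1 := by positivity
  -- For this `t` the first-order term dominates the second-order one.
  obtain ⟨t, rfl⟩ : ∃ t, b = t * (|c| + 1) := ⟨b / (|c| + 1), (div_mul_cancel₀ b hs.ne').symm⟩
  have h1 : t ^ 2 * (2 * (|c| + 1) + c) ≤ 0 := by linarith [h t]
  have h2 : 0 < 2 * (|c| + 1) + c := by linarith [neg_abs_le c, abs_nonneg c]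
  have h3 : t ^ 2 ≤ 0 := nonpos_of_mul_nonpos_left h1 h2
  rw [pow_eq_zero_iff two_ne_zero |>.1 (le_antisymm h3 (sq_nonneg t)), zero_mul]

namespace SimpleGraph

variable {V : Type*} [Fintype V]

/-- At a zero of `u` a sum of nonnegative terms vanishes, so `u` vanishes at all neighbours;
connectedness spreads this. -/
theorem eq_zero_of_sum_mul_eq {G : SimpleGraph V} (hG : G.Connected) {a : V → V → ℝ}
    (ha : ∀ i j, 0 ≤ a i j) (hpos : ∀ i j, G.Adj i j → 0 < a i j) {c : V → ℝ} {u : V → ℝ}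
    (hu : ∀ i, 0 ≤ u i) (heq : ∀ i, ∑ j, a i j * u j = c i * u i) {i₀ : V} (h0 : u i₀ = 0) :
    u = 0 := by
  have hstep : ∀ i j, G.Adj i j → u i = 0 → u j = 0 := by
    intro i j hij hi
    have h := heq i
    rw [hi, mul_zero, Finset.sum_eq_zero_iff_of_nonneg
      fun j _ => mul_nonneg (ha i j) (hu j)] at h
    exact (mul_eq_zero.1 (h j (Finset.mem_univ j))).resolve_left (hpos i j hij).ne'
  have hwalk : ∀ i j, G.Walk i j → u i = 0 → u j = 0 := by
    intro i j w
    induction w with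
    | nil => exact id
    | cons h _ ih => exact fun hi => ih (hstep _ _ h hi)
  funext j
  obtain ⟨w⟩ := hG.preconnected i₀ j
  exact hwalk _ _ w h0

/-- Perron–Frobenius for the quadratic form of a connected weighted graph: the maximum over the
unit sphere of a weighted `ℓ²` norm is attained at exactly one nonnegative vector, and that vector
is an eigenvector. -/
theorem exists_unique_nonneg_maximizer {G : SimpleGraph V} (hG : G.Connected) {a : V → V → ℝ}
    (hsymm : ∀ i j, a i j = a j i) (ha : ∀ i j, 0 ≤ a i j) (hpos : ∀ i j, G.Adj i j → 0 < a i j)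
    {μ : V → ℝ} (hμ : ∀ i, 0 < μ i) :
    ∃ (g : V → ℝ) (Λ : ℝ), (∀ i, 0 ≤ g i) ∧ ∑ i, μ i * g i ^ 2 = 1 ∧
      (∀ i, ∑ j, a i j * g j = Λ * μ i * g i) ∧
      ∑ i, ∑ j, a i j * (g i * g j) = Λ ∧
      (∀ v : V → ℝ, ∑ i, ∑ j, a i j * (v i * v j) ≤ Λ * ∑ i, μ i * v i ^ 2) ∧
      ∀ u : V → ℝ, (∀ i, 0 ≤ u i) → ∑ i, μ i * u i ^ 2 = 1 →
        Λ ≤ ∑ i, ∑ j, a i j * (u i * u j) → u = g := by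
  have := hG.nonempty
  let Q : (V → ℝ) → ℝ := fun v => ∑ i, ∑ j, a i j * (v i * v j)
  let N : (V → ℝ) → ℝ := fun v => ∑ i, μ i * v i ^ 2
  have hQc : Continuous Q := by fun_prop
  have hNc : Continuous N := by fun_prop
  have hNpos : ∀ v, v ≠ 0 → 0 < N v := fun v hv => by
    obtain ⟨i, hi⟩ := Function.ne_iff.1 hv
    have hi' : v i ≠ 0 := hi
    exact Finset.sum_pos' (fun j _ => mul_nonneg (hμ j).le (sq_nonneg _))
      ⟨i, Finset.mem_univ i, mul_pos (hμ i) (by positivity)⟩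
  have hQs : ∀ (c : ℝ) v, Q (c • v) = c ^ 2 * Q v := fun c v => by
    simp only [Q, Finset.mul_sum, Pi.smul_apply, smul_eq_mul]
    refine Finset.sum_congr rfl fun i _ => Finset.sum_congr rfl fun j _ => by ring
  have hNs : ∀ (c : ℝ) v, N (c • v) = c ^ 2 * N v := fun c v => by
    simp only [N, Finset.mul_sum, Pi.smul_apply, smul_eq_mul]
    refine Finset.sum_congr rfl fun i _ => by ring
  have hnorm : ∀ v, v ≠ 0 → N ((√(N v))⁻¹ • v) = 1 := fun v hv => by
    rw [hNs, inv_pow, Real.sq_sqrt (hNpos v hv).le, inv_mul_cancel₀ (hNpos v hv).ne']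
  let K : Set (V → ℝ) := {v | 0 ≤ v} ∩ {v | N v = 1}
  have hK : IsCompact K := by
    refine Metric.isCompact_of_isClosed_isBounded
      ((isClosed_le continuous_const continuous_id).inter (isClosed_eq hNc continuous_const)) ?_
    refine (Metric.isBounded_Icc (α := V → ℝ) 0 (fun i => √((μ i)⁻¹))).subset fun v hv => ?_
    refine ⟨hv.1, fun i => Real.le_sqrt_of_sq_le ?_⟩
    have h1 : μ i * v i ^ 2 ≤ 1 := by
      rw [← (hv.2 : N v = 1)]
      exact Finset.single_le_sum (f := fun i => μ i * v i ^ 2)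
        (fun j _ => mul_nonneg (hμ j).le (sq_nonneg _)) (Finset.mem_univ i)
    rw [← one_div, le_div_iff₀ (hμ i)]
    linarith
  have hKne : K.Nonempty := by
    refine ⟨(√(N 1))⁻¹ • 1, ?_, hnorm 1 one_ne_zero⟩
    exact fun i => by simp
  obtain ⟨g, hgK, hmax⟩ := hK.exists_isMaxOn hKne hQc.continuousOn
  have hmax' := isMaxOn_iff.1 hmax
  have hQabs : ∀ v, Q v ≤ Q |v| := fun v => by
    refine Finset.sum_le_sum fun i _ => Finset.sum_le_sum fun j _ =>
      mul_le_mul_of_nonneg_left ?_ (ha i j)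
    rw [Pi.abs_apply, Pi.abs_apply, ← abs_mul]
    exact le_abs_self _
  have hNabs : ∀ v, N |v| = N v := fun v => by simp [N]
  -- Replacing `v` by `|v|` does not decrease `Q` and keeps `N`, so the maximum over nonnegative
  -- vectors bounds all vectors.
  have hle : ∀ v, Q v ≤ Q g * N v := by
    intro v
    rcases eq_or_ne v 0 with rfl | hv
    · simp [Q, N]
    have hv' : |v| ≠ 0 := by simpa using hv
    have h1 := hmax' ((√(N |v|))⁻¹ • |v|) ⟨fun i => by simp; positivity, hnorm _ hv'⟩
    rw [hQs, inv_pow, Real.sq_sqrt (hNpos _ hv').le, hNabs, inv_mul_eq_div,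
      div_le_iff₀ (hNpos v hv)] at h1
    exact (hQabs v).trans h1
  -- First variation in the direction of the coordinate `i`, at any vector attaining the bound.
  have heig : ∀ u, Q g * N u ≤ Q u → ∀ i, ∑ j, a i j * u j = Q g * μ i * u i := by
    classical
    intro u hu i
    have hQexp : ∀ t : ℝ, Q (u + t • (Pi.single i 1 : V → ℝ)) =
        Q u + 2 * t * ∑ j, a i j * u j + t ^ 2 * a i i := by
      intro t
      have hterm : ∀ k l, a k l * ((u + t • (Pi.single i 1 : V → ℝ)) k *
          (u + t • (Pi.single i 1 : V → ℝ)) l) =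
          a k l * (u k * u l) + t * (if k = i then a k l * u l else 0)
            + t * (if l = i then a k l * u k else 0)
            + t ^ 2 * (if k = i then (if l = i then a k l else 0) else 0) := by
        intro k l
        simp only [Pi.add_apply, Pi.smul_apply, Pi.single_apply, smul_eq_mul]
        split_ifs <;> ring
      simp only [Q, hterm, Finset.sum_add_distrib, ← Finset.mul_sum]
      have e1 : ∑ k, ∑ l, (if k = i then a k l * u l else 0) = ∑ j, a i j * u j := by
        rw [Finset.sum_comm]; simp
      have e2 : ∑ k, ∑ l, (if l = i then a k l * u k else 0) = ∑ j, a i j * u j := by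
        simp [hsymm _ i]
      have e3 : ∑ k, ∑ l, (if k = i then (if l = i then a k l else 0) else 0) = a i i := by
        rw [Finset.sum_comm]; simp
      rw [e1, e2, e3]
      ring
    have hNexp : ∀ t : ℝ, N (u + t • (Pi.single i 1 : V → ℝ)) =
        N u + 2 * t * (μ i * u i) + t ^ 2 * μ i := by
      intro t
      have hterm : ∀ k, μ k * (u + t • (Pi.single i 1 : V → ℝ)) k ^ 2 =
          μ k * u k ^ 2 + 2 * t * (if k = i then μ k * u k else 0)
            + t ^ 2 * (if k = i then μ k else 0) := by
        intro k
        simp only [Pi.add_apply, Pi.smul_apply, Pi.single_apply, smul_eq_mul]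
        split_ifs <;> ring
      simp only [N, hterm, Finset.sum_add_distrib, ← Finset.mul_sum]
      simp
    have h0 : ∑ j, a i j * u j - Q g * (μ i * u i) = 0 := by
      refine eq_zero_of_forall_two_mul_mul_add_nonpos (c := a i i - Q g * μ i) fun t => ?_
      have h1 := hle (u + t • (Pi.single i 1 : V → ℝ))
      rw [hQexp, hNexp] at h1
      nlinarith
    linarith
  have hgeig := heig g (by rw [(hgK.2 : N g = 1), mul_one])
  have hg0 : g ≠ 0 := by
    rintro rfl
    have : N 0 = 1 := hgK.2
    simp [N] at this
  have hgpos : ∀ i, 0 < g i := fun i => (hgK.1 i).lt_of_ne' fun h =>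
    hg0 (eq_zero_of_sum_mul_eq hG ha hpos hgK.1 hgeig h)
  refine ⟨g, Q g, hgK.1, hgK.2, hgeig, rfl, hle, fun u hu hNu hQu => ?_⟩
  have hueig := heig u (by
    change N u = 1 at hNu
    rw [hNu, mul_one]
    exact hQu)
  -- With `c` the least ratio, `u - c • g` is a nonnegative solution that vanishes at `k`, hence is
  -- zero.
  obtain ⟨k, hk⟩ := Finite.exists_min fun i => u i / g i
  set c := u k / g k with hc
  have hc0 : 0 ≤ c := div_nonneg (hu k) (hgpos k).le
  have hdiff : u - c • g = 0 := by
    refine eq_zero_of_sum_mul_eq hG ha hpos (c := fun i => Q g * μ i) (fun i => ?_) (fun i => ?_)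
      (i₀ := k) ?_
    · have := (le_div_iff₀ (hgpos i)).1 (hk i)
      simpa using this
    · have h1 := hueig i
      have h2 := hgeig i
      simp only [Pi.sub_apply, Pi.smul_apply, smul_eq_mul, mul_sub, Finset.sum_sub_distrib]
      rw [h1]
      have : ∑ j, a i j * (c * g j) = c * ∑ j, a i j * g j := by
        rw [Finset.mul_sum]
        exact Finset.sum_congr rfl fun j _ => by ring
      rw [this, h2]
      ring
    · simp [hc, div_mul_cancel₀ _ (hgpos k).ne']
  have hug : u = c • g := sub_eq_zero.1 hdiff
  have hc1 : c = 1 := by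
    have h1 : N u = 1 := hNu
    rw [hug, hNs, (hgK.2 : N g = 1), mul_one] at h1
    nlinarith
  rw [hug, hc1, one_smul]

end SimpleGraph

/-! ### Comparison of the energy with the adjacency form -/

namespace SignedGraph

variable {V : Type*}

open Classical in
/-- The edge weight extended by zero to all pairs of vertices. -/
def edgeWeight (Γ : SignedGraph V) (i j : V) : ℝ :=
  if Γ.graph.Adj i j then Γ.weight s(i, j) else 0

theorem edgeWeight_pos (Γ : SignedGraph V) {i j : V} (h : Γ.graph.Adj i j) :
    0 < Γ.edgeWeight i j := by
  rw [edgeWeight, if_pos h]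
  exact Γ.weight_pos _ h

theorem edgeWeight_nonneg (Γ : SignedGraph V) (i j : V) : 0 ≤ Γ.edgeWeight i j := by
  by_cases h : Γ.graph.Adj i j
  · exact (Γ.edgeWeight_pos h).le
  · rw [edgeWeight, if_neg h]

theorem edgeWeight_comm (Γ : SignedGraph V) (i j : V) : Γ.edgeWeight i j = Γ.edgeWeight j i := by
  rw [edgeWeight, edgeWeight, Sym2.eq_swap, Γ.graph.adj_comm]

theorem sgn_eq_neg_one {Γ : SignedGraph V} (hneg : ∀ e ∈ Γ.graph.edgeSet, Γ.sign e = -1) {i j : V}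
    (h : Γ.graph.Adj i j) : Γ.sgn i j = -1 := by
  rw [sgn, hneg _ h]
  simp

theorem adjacency_negation {Γ : SignedGraph V} (hneg : ∀ e ∈ Γ.graph.edgeSet, Γ.sign e = -1) :
    Γ.negation.adjacency = Matrix.of Γ.edgeWeight := by
  ext i j
  by_cases h : Γ.graph.Adj i j
  · simp [adjacency, edgeWeight, negation, sgn, h, hneg s(i, j) h]
  · simp [adjacency, edgeWeight, negation, h]

variable [Fintype V]

theorem normalizedAdjacency_negation_mulVec [DecidableEq V] {Γ : SignedGraph V}
    (hneg : ∀ e ∈ Γ.graph.edgeSet, Γ.sign e = -1) (v : V → ℝ) (i : V) :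
    (Γ.negation.normalizedAdjacency.mulVec v) i =
      (Γ.measure i)⁻¹ * ∑ j, Γ.edgeWeight i j * v j := by
  have hinv : (Matrix.diagonal Γ.negation.measure)⁻¹ =
      Matrix.diagonal fun i => (Γ.measure i)⁻¹ := by
    refine Matrix.inv_eq_left_inv ?_
    rw [Matrix.diagonal_mul_diagonal, ← Matrix.diagonal_one]
    congr 1
    funext i
    exact inv_mul_cancel₀ (Γ.measure_pos i).ne'
  rw [normalizedAdjacency, hinv, adjacency_negation hneg, ← Matrix.mulVec_mulVec,
    Matrix.mulVec_diagonal]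
  rfl

theorem edgeEnergy_eq {Γ : SignedGraph V} (hneg : ∀ e ∈ Γ.graph.edgeSet, Γ.sign e = -1) (p : ℝ)
    (f : V → ℝ) : Γ.edgeEnergy p f = (∑ i, ∑ j, Γ.edgeWeight i j * |f i + f j| ^ p) / 2 := by
  rw [edgeEnergy]
  congr 1
  refine Finset.sum_congr rfl fun i _ => Finset.sum_congr rfl fun j _ => ?_
  by_cases h : Γ.graph.Adj i j
  · rw [edgeWeight, if_pos h, if_pos h, sgn_eq_neg_one hneg h, neg_one_mul, sub_neg_eq_add]
  · rw [edgeWeight, if_neg h, if_neg h, zero_mul]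

/-- The sum of the weighted power means of the values at adjacent vertices. -/
def powerMeanForm (Γ : SignedGraph V) (p : ℝ) (u : V → ℝ) : ℝ :=
  ∑ i, ∑ j, Γ.edgeWeight i j * powerMeanSq p (u i) (u j)

theorem continuous_powerMeanForm (Γ : SignedGraph V) {p : ℝ} (hp : 0 < p) :
    Continuous (Γ.powerMeanForm p) :=
  continuous_finsetSum _ fun i _ => continuous_finsetSum _ fun j _ => continuous_const.mul
    (Continuous.comp (g := fun x : ℝ × ℝ => powerMeanSq p x.1 x.2)
      (f := fun u : V → ℝ => (u i, u j)) (continuous_powerMeanSq hp)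
      ((continuous_apply i).prodMk (continuous_apply j)))

theorem rpow_half_rpow {p x : ℝ} (hp : 0 < p) (hx : 0 ≤ x) : (x ^ (p / 2)) ^ (2 / p) = x := by
  rw [← Real.rpow_mul hx, div_mul_div_cancel₀' hp.ne', div_self two_ne_zero, Real.rpow_one]

theorem rpow_half_sq {p x : ℝ} (hx : 0 ≤ x) : (x ^ (p / 2)) ^ 2 = x ^ p := by
  rw [← Real.rpow_natCast, ← Real.rpow_mul hx]
  norm_num

theorem two_rpow_mul_powerMeanSq {p x y : ℝ} (hp : 0 < p) (hx : 0 ≤ x) (hy : 0 ≤ y) :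
    2 ^ p * powerMeanSq p (x ^ (p / 2)) (y ^ (p / 2)) = (x + y) ^ p := by
  rw [powerMeanSq, rpow_half_rpow hp hx, rpow_half_rpow hp hy, ← Real.mul_rpow (by norm_num)
    (by positivity), mul_div_cancel₀ _ two_ne_zero]

theorem edgeEnergy_le {Γ : SignedGraph V} (hneg : ∀ e ∈ Γ.graph.edgeSet, Γ.sign e = -1) {p : ℝ}
    (hp : 0 < p) (f : V → ℝ) :
    Γ.edgeEnergy p f ≤ 2 ^ p / 2 * Γ.powerMeanForm p (fun i => |f i| ^ (p / 2)) := by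
  rw [edgeEnergy_eq hneg, div_mul_eq_mul_div, powerMeanForm, Finset.mul_sum]
  refine div_le_div_of_nonneg_right (Finset.sum_le_sum fun i _ => ?_) zero_le_two
  rw [Finset.mul_sum]
  refine Finset.sum_le_sum fun j _ => ?_
  rw [mul_left_comm, two_rpow_mul_powerMeanSq hp (abs_nonneg _) (abs_nonneg _)]
  exact mul_le_mul_of_nonneg_left
    (Real.rpow_le_rpow (abs_nonneg _) (abs_add_le _ _) hp.le) (Γ.edgeWeight_nonneg i j)

/-- AM–GM at each edge; this is the lower bound for the test function `u ^ (2 / p)`. -/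
theorem le_edgeEnergy {Γ : SignedGraph V} (hneg : ∀ e ∈ Γ.graph.edgeSet, Γ.sign e = -1) {p : ℝ}
    (hp : 0 < p) {u : V → ℝ} (hu : ∀ i, 0 ≤ u i) :
    2 ^ p / 2 * ∑ i, ∑ j, Γ.edgeWeight i j * (u i * u j) ≤
      Γ.edgeEnergy p (fun i => u i ^ (2 / p)) := by
  rw [edgeEnergy_eq hneg, div_mul_eq_mul_div, Finset.mul_sum]
  refine div_le_div_of_nonneg_right (Finset.sum_le_sum fun i _ => ?_) zero_le_two
  rw [Finset.mul_sum]
  refine Finset.sum_le_sum fun j _ => ?_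
  have hi := hu i
  have hj := hu j
  rw [mul_left_comm, abs_of_nonneg (by positivity)]
  refine mul_le_mul_of_nonneg_left ?_ (Γ.edgeWeight_nonneg i j)
  have h : (u i ^ (2 / p) + u j ^ (2 / p)) ^ p = 2 ^ p * powerMeanSq p (u i) (u j) := by
    rw [powerMeanSq, ← Real.mul_rpow (by norm_num) (by positivity), mul_div_cancel₀ _ two_ne_zero]
  rw [h]
  exact mul_le_mul_of_nonneg_left (mul_le_powerMeanSq hp hi hj) (by positivity)

/-- A bound for the potential term on the unit sphere. -/
def potentialBound (Γ : SignedGraph V) : ℝ := ∑ i, |Γ.potential i| / Γ.measure i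

theorem abs_sum_potential_le {Γ : SignedGraph V} {u : V → ℝ}
    (hu : ∑ i, Γ.measure i * u i ^ 2 = 1) :
    |∑ i, Γ.potential i * u i ^ 2| ≤ Γ.potentialBound := by
  refine (Finset.abs_sum_le_sum_abs _ _).trans (Finset.sum_le_sum fun i _ => ?_)
  have h1 : Γ.measure i * u i ^ 2 ≤ 1 := by
    rw [← hu]
    exact Finset.single_le_sum (f := fun i => Γ.measure i * u i ^ 2)
      (fun j _ => mul_nonneg (Γ.measure_pos j).le (sq_nonneg _)) (Finset.mem_univ i)
  rw [abs_mul, abs_of_nonneg (sq_nonneg (u i)), le_div_iff₀ (Γ.measure_pos i)]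
  nlinarith [abs_nonneg (Γ.potential i)]

theorem sum_rpow_half_sq (c f : V → ℝ) (p : ℝ) :
    ∑ i, c i * (|f i| ^ (p / 2)) ^ 2 = ∑ i, c i * |f i| ^ p := by
  simp only [rpow_half_sq (abs_nonneg _)]

/-- The power mean form of a maximizer of the Rayleigh quotient is almost as large as the value of
the adjacency form at any unit vector. -/
theorem le_powerMeanForm_of_isEigenpair [Nonempty V] {Γ : SignedGraph V}
    (hneg : ∀ e ∈ Γ.graph.edgeSet, Γ.sign e = -1) {p : ℝ} (hp : 1 < p) {f : V → ℝ}
    (hf : f ∈ Γ.unitSphere p)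
    (heig : Γ.IsEigenpair p (Γ.variationalEigenvalue p (Fintype.card V)) f)
    {u : V → ℝ} (hu : ∀ i, 0 ≤ u i) (hu1 : ∑ i, Γ.measure i * u i ^ 2 = 1) :
    ∑ i, ∑ j, Γ.edgeWeight i j * (u i * u j) - 4 * Γ.potentialBound * (1 / 2) ^ p ≤
      Γ.powerMeanForm p (fun i => |f i| ^ (p / 2)) := by
  have hp0 : 0 < p := zero_lt_one.trans hp
  have hpow : ∀ i, |u i ^ (2 / p)| ^ p = u i ^ 2 := fun i => by
    rw [abs_of_nonneg (Real.rpow_nonneg (hu i) _), ← Real.rpow_mul (hu i),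
      div_mul_cancel₀ _ hp0.ne', Real.rpow_two]
  have hv : (fun i => u i ^ (2 / p)) ∈ Γ.unitSphere p := by
    simpa only [unitSphere, Set.mem_ofPred_eq, hpow] using hu1
  have h1 := le_variationalEigenvalue_card hp0 hv
  rw [heig.eq_of_mem_unitSphere hp hf] at h1
  simp only [hpow] at h1
  have h2 := edgeEnergy_le hneg hp0 f
  have h3 := le_edgeEnergy hneg hp0 hu
  have h4 := abs_le.1 (abs_sum_potential_le hu1)
  have hf1 : ∑ i, Γ.measure i * (|f i| ^ (p / 2)) ^ 2 = 1 := by rw [sum_rpow_half_sq]; exact hf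
  have h5 := abs_le.1 (abs_sum_potential_le hf1)
  rw [sum_rpow_half_sq] at h5
  have h6 : (2 : ℝ) ^ p * (1 / 2) ^ p = 1 := by
    rw [← Real.mul_rpow (by norm_num) (by norm_num)]
    norm_num
  have h7 : (0 : ℝ) < 2 ^ p := by positivity
  refine le_of_mul_le_mul_left ?_ h7
  -- The two potential terms cost at most `2 * potentialBound`; dividing by the prefactor `2 ^ p /
  -- 2` gives the constant `4`.
  linear_combination 2 * h1 + 2 * h2 + 2 * h3 + 2 * h4.1 + 2 * h5.2 - 4 * Γ.potentialBound * h6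

end SignedGraph

end

/-! ### The limit of the top eigenfunctions -/

theorem theorem5p3 {V : Type*} [Fintype V] [DecidableEq V] (Γ : SignedGraph V)
    (hconn : Γ.graph.Connected)
    (hneg : ∀ e ∈ Γ.graph.edgeSet, Γ.sign e = -1)
    (f : ℝ → V → ℝ)
    (hunit : ∀ p : ℝ, 1 < p → f p ∈ Γ.unitSphere p)
    (heig : ∀ p : ℝ, 1 < p →
      Γ.IsEigenpair p (Γ.variationalEigenvalue p (Fintype.card V)) (f p)) :
    ∃ g : V → ℝ,
      (∀ i, Tendsto (fun p : ℝ => |f p i| ^ (p / 2)) atTop (𝓝 (g i))) ∧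
      ∃ Λ : ℝ,
        IsGreatest {t : ℝ | Module.End.HasEigenvalue
          (Matrix.toLin' Γ.negation.normalizedAdjacency) t} Λ ∧
        Module.End.HasEigenvector (Matrix.toLin' Γ.negation.normalizedAdjacency) Λ g := by
  have := hconn.nonempty
  obtain ⟨g, Λ, hg0, hg1, hgeig, hgQ, hle, huniq⟩ := SimpleGraph.exists_unique_nonneg_maximizer
    hconn Γ.edgeWeight_comm Γ.edgeWeight_nonneg (fun i j => Γ.edgeWeight_pos) Γ.measure_pos
  have hvec : Module.End.HasEigenvector
      (Matrix.toLin' Γ.negation.normalizedAdjacency) Λ g := by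
    refine ⟨Module.End.mem_eigenspace_iff.2 (funext fun i => ?_), ?_⟩
    · rw [Matrix.toLin'_apply, SignedGraph.normalizedAdjacency_negation_mulVec hneg, hgeig,
        Pi.smul_apply, smul_eq_mul, mul_comm Λ, mul_assoc,
        inv_mul_cancel_left₀ (Γ.measure_pos i).ne']
    · rintro rfl
      simp at hg1
  refine ⟨g, ?_, Λ, ⟨Module.End.hasEigenvalue_of_hasEigenvector hvec, ?_⟩, hvec⟩
  · rw [← tendsto_pi_nhds]
    set u : ℝ → V → ℝ := fun p i => |f p i| ^ (p / 2) with hu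
    have hu0 : ∀ p i, 0 ≤ u p i := fun p i => Real.rpow_nonneg (abs_nonneg _) _
    have hu1 : ∀ p, 1 < p → ∑ i, Γ.measure i * u p i ^ 2 = 1 := fun p hp => by
      rw [SignedGraph.sum_rpow_half_sq]
      exact hunit p hp
    let K : Set (V → ℝ) := Γ.unitSphere 2 ∩ {v | ∀ i, 0 ≤ v i}
    have hKclosed : IsClosed {v : V → ℝ | ∀ i, 0 ≤ v i} := by
      simp only [Set.ofPred_forall]
      exact isClosed_iInter fun i => isClosed_le continuous_const (continuous_apply i)
    have hK : IsCompact K := (Γ.isCompact_unitSphere two_pos).inter_right hKclosed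
    have huK : ∀ᶠ p in atTop, u p ∈ K := by
      filter_upwards [eventually_gt_atTop 1] with p hp
      refine ⟨?_, hu0 p⟩
      have := hu1 p hp
      simpa [SignedGraph.unitSphere] using this
    -- In the compact set `K` it suffices that `g` is the only possible cluster point.
    refine hK.tendsto_nhds_of_unique_mapClusterPt huK fun v hv hcl => ?_
    have hv1 : ∑ i, Γ.measure i * v i ^ 2 = 1 := by
      have := hv.1
      simpa [SignedGraph.unitSphere] using this
    refine huniq v hv.2 hv1 ?_
    -- For `p ≥ q` the form with exponent `p` is at most the one with `q`, which is continuous, so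
    -- the almost-maximality of `u p` survives at the cluster point `v`. Only then does `q → ∞`.
    have hform : ∀ q : ℝ, 0 < q → Λ ≤ Γ.powerMeanForm q v := by
      intro q hq
      refine le_of_forall_sub_le fun ε hε => ?_
      have hsmall : Tendsto (fun p : ℝ => 4 * Γ.potentialBound * (1 / 2 : ℝ) ^ p) atTop
          (𝓝 (4 * Γ.potentialBound * 0)) :=
        (tendsto_rpow_atTop_of_base_lt_one _ (by norm_num) (by norm_num)).const_mul _
      rw [mul_zero] at hsmall
      have hev : ∀ᶠ p in atTop, u p ∈ {w | Λ - ε ≤ Γ.powerMeanForm q w} := by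
        filter_upwards [eventually_gt_atTop 1, eventually_ge_atTop q,
          hsmall.eventually (gt_mem_nhds hε)] with p hp hpq hs
        have h1 := SignedGraph.le_powerMeanForm_of_isEigenpair hneg hp (hunit p hp) (heig p hp)
          hg0 hg1
        rw [hgQ] at h1
        have h2 : Γ.powerMeanForm p (u p) ≤ Γ.powerMeanForm q (u p) :=
          Finset.sum_le_sum fun i _ => Finset.sum_le_sum fun j _ =>
            mul_le_mul_of_nonneg_left (powerMeanSq_anti hq hpq (hu0 p i) (hu0 p j))
              (Γ.edgeWeight_nonneg i j)
        change Λ - ε ≤ Γ.powerMeanForm q (u p)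
        linarith
      exact (isClosed_le continuous_const (Γ.continuous_powerMeanForm hq)).mem_of_mapClusterPt
        hcl hev
    have hlim : Tendsto (fun q => Γ.powerMeanForm q v) atTop
        (𝓝 (∑ i, ∑ j, Γ.edgeWeight i j * (v i * v j))) :=
      tendsto_finsetSum _ fun i _ => tendsto_finsetSum _ fun j _ =>
        (tendsto_powerMeanSq (hv.2 i) (hv.2 j)).const_mul _
    exact ge_of_tendsto hlim ((eventually_gt_atTop 0).mono hform)
  -- Any eigenvalue is a quotient of the adjacency form by the weighted square norm, hence at most
  -- `Λ`.
  · intro t ht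
    obtain ⟨v, hv⟩ := Module.End.HasEigenvalue.exists_hasEigenvector ht
    have hveq : ∀ i, ∑ j, Γ.edgeWeight i j * v j = t * (Γ.measure i * v i) := fun i => by
      have h := congrFun hv.apply_eq_smul i
      rw [Matrix.toLin'_apply, SignedGraph.normalizedAdjacency_negation_mulVec hneg,
        Pi.smul_apply, smul_eq_mul, inv_mul_eq_iff_eq_mul₀ (Γ.measure_pos i).ne'] at h
      rw [h]
      ring
    have hN : 0 < ∑ i, Γ.measure i * v i ^ 2 := by
      simpa using Γ.sum_measure_abs_rpow_pos 2 hv.2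
    have hQ : ∑ i, ∑ j, Γ.edgeWeight i j * (v i * v j) = t * ∑ i, Γ.measure i * v i ^ 2 := by
      rw [Finset.mul_sum]
      refine Finset.sum_congr rfl fun i _ => ?_
      have : ∑ j, Γ.edgeWeight i j * (v i * v j) = v i * ∑ j, Γ.edgeWeight i j * v j := by
        rw [Finset.mul_sum]
        exact Finset.sum_congr rfl fun j _ => by ring
      rw [this, hveq]
      ring
    exact le_of_mul_le_mul_right (hQ ▸ hle v) hN
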